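/- For an integer $n\ge 2$ let $g_1(n)=n^2-1$, $g_2(n)=n^2-2\sqrt{n+3}+6$, $g_3(n)=n^2-\tfrac n6$, $g_4(n)=n^2-\tfrac{\sqrt5-1}{2}\,n+\tfrac{17}{\sqrt5}\sqrt n+1$ (the bounds of Dow and Metsch) and $g(n)=\min(g_1(n),g_2(n),g_3(n),g_4(n))$. A partial affine plane of order $n\ge2$ is a pair $\mathcal I=(\mathcal S,\mathcal A)$, where $\mathcal S$ is a set of $n^2$ points and $\mathcal A$ is a set of $n$-element subsets of $\mathcal S$ (lines), any two distinct lines having at most one common point. Two lines are parallel if they are equal or disjoint. The valency of a point is the number of lines of $\mathcal A$ containing it. An affine plane of order $n$ has $n^2$ points, $n$ points on each line, a unique line through any two distinct points, for each line $\ell$ and point $P\notin\ell$ a unique line through $P$ disjoint from $\ell$, and three non-collinear points; $\mathcal I$ can be completed if there is an affine plane $(\mathcal S,\mathcal A')$ of order $n$ with $\mathcal A\subseteq\mathcal A'$. A projective plane of order $n\ge 2$ has $n^2+n+1$ points and $n^2+n+1$ lines, each line being a set of $n+1$ points and any two distinct lines having at most one common point. We say that $\mathcal I$ embeds in a projective plane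 of order $n$ if there are such a plane and an injection of $\mathcal S$ into its point set such that, for each $\ell\in\mathcal A$, there is a line of the plane which contains the images of all points of $\ell$ and of no other points of positive valency. A $k$-group divisible design of type $t^u$ consists of $tu$ points, a partition of the points into $u$ groups of size $t$, and a set of $k$-element subsets (lines) such that two distinct points of the same group lie on no common line and two points of different groups lie on exactly one common line. Let $\mathcal I=(\mathcal S,\mathcal A)$ be a partial affine plane of order $n$ in which parallelism is an equivalence relation on $\mathcal A$ and which cannot be completed to an affine plane, and let $f$ be the positive real number with $f(f+1)=2n$. Then: 1. $|\mathcal A|\le\max(g(n)-1,\;n^2-\sqrt n)$. 2. If $|\mathcal A|>\max(g(n)-1,\;n^2-f)$, then $\mathcal I$ has a point of valency $0$ and embeds in a projective plane of order $n$. 3. If $|\mathcal A|=n^2-f=\max(g(n)-1,\;n^2-f)$ (equality in the bound of 2, attained by $n^2-f$), then either $\mathcal I$ has a point of valency $0$ and embeds in a projective plane of order $n$, or there is an $n$-group divisible design of type $(n-f)^{n+f+2}$ with $n^2-f$ points and $n^2-f$ lines. -/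

import Mathlib

/-! Point-line geometries on a finite point set `P`: the lines are the members of a finite set `A` of
subsets of `P`. -/

/-- `(P, A)` is a partial affine plane of order `n`. -/
structure IsPartialAffinePlane {P : Type*} [Fintype P] [DecidableEq P] (n : ℕ)
    (A : Finset (Finset P)) : Prop where
  two_le : 2 ≤ n
  card_points : Fintype.card P = n ^ 2
  card_line : ∀ L ∈ A, L.card = n
  meet : ∀ L ∈ A, ∀ M ∈ A, L ≠ M → (L ∩ M).card ≤ 1

/-- Two lines are parallel if they coincide or have no point in common. -/
def IsParallel {P : Type*} (L M : Finset P) : Prop :=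
  L = M ∨ Disjoint L M

/-- Parallelism is an equivalence relation on the set `A` of lines. -/
def ParallelismIsEquivalence {P : Type*} (A : Finset (Finset P)) : Prop :=
  Equivalence (fun L M : {L : Finset P // L ∈ A} => IsParallel L.1 M.1)

/-- The number of lines containing `p`. -/
def valency {P : Type*} [DecidableEq P] (A : Finset (Finset P)) (p : P) : ℕ :=
  (A.filter (fun L => p ∈ L)).card

/-- `(P, A)` is an affine plane of order `n`. -/
structure IsAffinePlane {P : Type*} [Fintype P] (n : ℕ) (A : Finset (Finset P)) : Prop where
  card_points : Fintype.card P = n ^ 2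
  card_line : ∀ L ∈ A, L.card = n
  join : ∀ p q : P, p ≠ q → ∃! L, L ∈ A ∧ p ∈ L ∧ q ∈ L
  playfair : ∀ L ∈ A, ∀ p, p ∉ L → ∃! M, M ∈ A ∧ p ∈ M ∧ Disjoint M L
  noncollinear : ∃ p q r : P, p ≠ q ∧ p ≠ r ∧ q ≠ r ∧ ¬ ∃ L ∈ A, p ∈ L ∧ q ∈ L ∧ r ∈ L

/-- `(P, A)` can be completed to an affine plane of order `n` by adding lines. -/
def IsCompletable {P : Type*} [Fintype P] (n : ℕ) (A : Finset (Finset P)) : Prop :=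
  ∃ A' : Finset (Finset P), A ⊆ A' ∧ IsAffinePlane n A'

/-- `(Q, B)` is a projective plane of order `n`: a partial projective plane of order `n`
(`n ^ 2 + n + 1` points, `n + 1` points on each line, two lines meeting in at most one point)
with `n ^ 2 + n + 1` lines. -/
structure IsProjectivePlane {Q : Type*} [Fintype Q] [DecidableEq Q] (n : ℕ)
    (B : Finset (Finset Q)) : Prop where
  two_le : 2 ≤ n
  card_points : Fintype.card Q = n ^ 2 + n + 1
  card_line : ∀ L ∈ B, L.card = n + 1
  meet : ∀ L ∈ B, ∀ M ∈ B, L ≠ M → (L ∩ M).card ≤ 1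
  card_lines : B.card = n ^ 2 + n + 1

/-- `(P, A)` embeds in a projective plane of order `n`: the points of `P` can be identified with
points of the plane such that every line of `A` is the trace, on the points of positive valency, of
a line of the plane. (Every point of a line of `A` has positive valency, so in particular each line
of `A` is contained in a line of the plane. The points of valency `0` may lie on the new lines: a
partial affine plane with more than `n + 1` parallel classes admits no embedding in which they
lie on no line that extends a line of `A`.) -/
def EmbedsInProjectivePlane {P : Type*} [DecidableEq P] (n : ℕ) (A : Finset (Finset P)) : Prop :=
  ∃ (Q : Type) (_ : Fintype Q) (_ : DecidableEq Q) (B : Finset (Finset Q)) (ι : P ↪ Q),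
    IsProjectivePlane n B ∧
      ∀ L ∈ A, ∃ L' ∈ B, ∀ p : P, 0 < valency A p → (ι p ∈ L' ↔ p ∈ L)

/-- `(Q, B)` with the groups `G.parts` is a `k`-group divisible design of type `t ^ u`. -/
structure IsGroupDivisibleDesign {Q : Type*} [Fintype Q] [DecidableEq Q] (k t u : ℕ)
    (G : Finpartition (Finset.univ : Finset Q)) (B : Finset (Finset Q)) : Prop where
  card_points : Fintype.card Q = t * u
  card_block : ∀ b ∈ B, b.card = k
  card_groups : G.parts.card = u
  card_group : ∀ g ∈ G.parts, g.card = t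
  same_group : ∀ g ∈ G.parts, ∀ p ∈ g, ∀ q ∈ g, p ≠ q → ¬ ∃ b ∈ B, p ∈ b ∧ q ∈ b
  different_groups : ∀ g ∈ G.parts, ∀ h ∈ G.parts, g ≠ h → ∀ p ∈ g, ∀ q ∈ h,
    ∃! b, b ∈ B ∧ p ∈ b ∧ q ∈ b

/-- The bounds `g₁, g₂, g₃, g₄` of Dow and Metsch. -/
noncomputable def boundOne (n : ℕ) : ℝ := (n : ℝ) ^ 2 - 1

noncomputable def boundTwo (n : ℕ) : ℝ := (n : ℝ) ^ 2 - 2 * Real.sqrt ((n : ℝ) + 3) + 6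

noncomputable def boundThree (n : ℕ) : ℝ := (n : ℝ) ^ 2 - (n : ℝ) / 6

noncomputable def boundFour (n : ℕ) : ℝ :=
  (n : ℝ) ^ 2 - (Real.sqrt 5 - 1) / 2 * (n : ℝ) + 17 / Real.sqrt 5 * Real.sqrt (n : ℝ) + 1

/-- `g = min (g₁, g₂, g₃, g₄)`. -/
noncomputable def dowMetschBound (n : ℕ) : ℝ :=
  min (min (boundOne n) (boundTwo n)) (min (boundThree n) (boundFour n))

/-! Extend every line of `A` by a point at infinity naming its parallel class. Lines now have `n +
1` points and any two meet exactly once, so this is a dual linear space with `|A| = n ^ 2 - e`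
lines. Everything is measured by the deficiency `d(p)`, which is `n + 1` minus the valency of `p`.

With at most `n + 1` parallel classes, `n + 1` points at infinity suffice, and they form one further
line, so `|A| + 1` lines live on `n ^ 2 + n + 1` points. The Dow-Metsch bounds make the remaining
defect small (`IsSmallDefect`), and missing lines can then be restored one at a time
(`exists_completion`). If `d(p) = 1`, then `p` and the points unjoined to it form a missing line. If
no such point exists, the sums of `d` and of `d (d - 2)` produce a point with `d(p) = 2`; its `2 n`
unjoined points split into two sets of pairwise unjoined points, each of which is a missing line
without `p`. Deleting the line at infinity from the resulting projective plane completes `A`, which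
is excluded.

With at least `n + 2` classes, `d ≥ 1` everywhere. Put `x = d - 1` and let `n ^ 2 + n + 1 - w` be
the number of covered points. On these `0 ≤ x ≤ e`, and `x (e - x)` sums to `n (e (e - w) - n (1 -
w))`. Together with Cauchy-Schwarz for the class sizes this leaves two cases when `e (e + 1) ≤ 2 n`
(`card_classes_eq`). Either `w = 0` and `n ≤ e ^ 2`: then so many points have `d = 1` that the
missing lines can be added greedily, which gives the embedding. Or `w = -1` and `e (e + 1) = 2 n`:
then every `x` is `0` or `e`, and the dual structure is the group divisible design. -/

/-- A dual linear space of order `n`: lines have `n + 1` points and any two distinct lines have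
exactly one common point. -/
structure IsDualLinearSpace {V : Type*} [DecidableEq V] (n : ℕ) (B : Finset (Finset V)) :
    Prop where
  card_line : ∀ L ∈ B, L.card = n + 1
  meet : ∀ L ∈ B, ∀ M ∈ B, L ≠ M → (L ∩ M).card = 1

/-- The points different from `p` that are on no common line with `p`. -/
def unjoined {V : Type*} [Fintype V] [DecidableEq V] (B : Finset (Finset V)) (p : V) : Finset V :=
  Finset.univ.filter (fun q => q ≠ p ∧ ∀ L ∈ B, p ∈ L → q ∉ L)

/-! ### Incidence counts in dual linear spaces. -/

theorem sum_valency {V : Type*} [DecidableEq V] (B : Finset (Finset V)) (T : Finset V) :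
    ∑ p ∈ T, valency B p = ∑ M ∈ B, (M ∩ T).card := by
  have h := Finset.sum_card_bipartiteAbove_eq_sum_card_bipartiteBelow (s := T) (t := B)
    (fun (p : V) (L : Finset V) => p ∈ L)
  simp only [Finset.bipartiteAbove, Finset.bipartiteBelow] at h
  unfold valency
  rw [h]
  refine Finset.sum_congr rfl fun M _ => ?_
  congr 1
  ext x
  simp [and_comm]

/-- Taking `w` to be the valency itself turns this into the second moment of the valencies. -/
theorem sum_valency_mul {V : Type*} [Fintype V] [DecidableEq V] (B : Finset (Finset V))
    (w : V → ℤ) : ∑ p, (valency B p : ℤ) * w p = ∑ M ∈ B, ∑ p ∈ M, w p := by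
  have h : ∀ p, (valency B p : ℤ) * w p = ∑ M ∈ B, if p ∈ M then w p else 0 := by
    intro p
    rw [← Finset.sum_filter, Finset.sum_const, nsmul_eq_mul, valency]
  simp_rw [h]
  rw [Finset.sum_comm]
  refine Finset.sum_congr rfl fun M _ => ?_
  rw [← Finset.sum_filter]
  congr 1
  ext x
  simp

theorem valency_pos_iff {V : Type*} [DecidableEq V] {B : Finset (Finset V)} {p : V} :
    0 < valency B p ↔ ∃ L ∈ B, p ∈ L := by
  rw [valency, Finset.card_pos]
  simp [Finset.Nonempty]

namespace IsDualLinearSpace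

variable {V : Type*} [DecidableEq V] {n : ℕ} {B : Finset (Finset V)}

theorem line_eq (hB : IsDualLinearSpace n B) {L M : Finset V} (hL : L ∈ B) (hM : M ∈ B) {p q : V}
    (hpq : p ≠ q) (hpL : p ∈ L) (hqL : q ∈ L) (hpM : p ∈ M) (hqM : q ∈ M) : L = M := by
  by_contra h
  have h1 := hB.meet L hL M hM h
  obtain ⟨a, ha⟩ := Finset.card_eq_one.1 h1
  have h2 : p ∈ L ∩ M := Finset.mem_inter.2 ⟨hpL, hpM⟩
  have h3 : q ∈ L ∩ M := Finset.mem_inter.2 ⟨hqL, hqM⟩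
  rw [ha, Finset.mem_singleton] at h2 h3
  exact hpq (h2.trans h3.symm)

theorem sum_valency_line (hB : IsDualLinearSpace n B) {L : Finset V} (hL : L ∈ B) :
    ∑ p ∈ L, valency B p = B.card + n := by
  rw [sum_valency, ← Finset.add_sum_erase B _ hL, Finset.inter_self, hB.card_line L hL,
    Finset.sum_congr rfl (g := fun _ => 1)]
  · rw [Finset.sum_const, smul_eq_mul, mul_one, Finset.card_erase_of_mem hL]
    have := Finset.card_pos.2 ⟨L, hL⟩
    omega
  · intro M hM
    rw [Finset.mem_erase] at hM
    exact hB.meet M hM.2 L hL hM.1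

theorem insert_transversal (hB : IsDualLinearSpace n B) {T : Finset V} (hn : 1 ≤ n)
    (hT : T.card = n + 1) (h : ∀ M ∈ B, (M ∩ T).card = 1) :
    IsDualLinearSpace n (insert T B) ∧ (insert T B).card = B.card + 1 := by
  have hTB : T ∉ B := by
    intro hTB
    have := h T hTB
    rw [Finset.inter_self] at this
    omega
  refine ⟨⟨?_, ?_⟩, Finset.card_insert_of_notMem hTB⟩
  · intro L hL
    rcases Finset.mem_insert.1 hL with rfl | hL
    · exact hT
    · exact hB.card_line L hL
  · intro L hL M hM hLM
    rcases Finset.mem_insert.1 hL with rfl | hL' <;> rcases Finset.mem_insert.1 hM with rfl | hM'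
    · exact absurd rfl hLM
    · rw [Finset.inter_comm]; exact h M hM'
    · exact h L hL'
    · exact hB.meet L hL' M hM' hLM

variable [Fintype V]

theorem sum_valency_univ (hB : IsDualLinearSpace n B) :
    ∑ p, valency B p = (n + 1) * B.card := by
  rw [sum_valency, Finset.sum_congr rfl (g := fun _ => n + 1)]
  · rw [Finset.sum_const, smul_eq_mul, mul_comm]
  · intro M hM
    rw [Finset.inter_univ, hB.card_line M hM]

theorem sum_valency_sq (hB : IsDualLinearSpace n B) :
    ∑ p, (valency B p : ℤ) ^ 2 = B.card * (B.card + n) := by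
  simp_rw [sq]
  rw [sum_valency_mul, Finset.sum_congr rfl (g := fun _ => (B.card + n : ℤ))]
  · rw [Finset.sum_const, nsmul_eq_mul]
  · intro L hL
    exact_mod_cast hB.sum_valency_line hL

/-- Lines through `q` share only `q`, so they partition the points of `T` joined to `q`. Most counts
below are instances, with `T` a line, the whole space, an unjoined set or the set of points at
infinity. -/
theorem card_eq_add_sum (hB : IsDualLinearSpace n B) {q : V} {T : Finset V} (hq : q ∉ T) :
    T.card = (T ∩ unjoined B q).card + ∑ L ∈ B.filter (fun L => q ∈ L), (L ∩ T).card := by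
  have h1 : T \ unjoined B q = (B.filter (fun L => q ∈ L)).biUnion (fun L => L ∩ T) := by
    ext x
    simp only [Finset.mem_sdiff, unjoined, Finset.mem_filter, Finset.mem_univ, true_and,
      Finset.mem_biUnion, Finset.mem_inter]
    constructor
    · rintro ⟨hx, h⟩
      push Not at h
      obtain ⟨L, hL, hqL, hxL⟩ := h (by rintro rfl; exact hq hx)
      exact ⟨L, ⟨hL, hqL⟩, hxL, hx⟩
    · rintro ⟨L, ⟨hL, hqL⟩, hxL, hx⟩
      exact ⟨hx, fun h => h.2 L hL hqL hxL⟩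
  have h2 : (T \ unjoined B q).card = ∑ L ∈ B.filter (fun L => q ∈ L), (L ∩ T).card := by
    rw [h1, Finset.card_biUnion]
    intro L hL M hM hLM
    rw [Finset.mem_coe, Finset.mem_filter] at hL hM
    rw [Function.onFun, Finset.disjoint_left]
    intro x hxL hxM
    rw [Finset.mem_inter] at hxL hxM
    exact hLM (hB.line_eq hL.1 hM.1 (p := q) (q := x) (by rintro rfl; exact hq hxL.2)
      hL.2 hxL.1 hM.2 hxM.1)
  rw [← h2, add_comm]
  exact (Finset.card_sdiff_add_card_inter T _).symm

theorem mem_unjoined {p q : V} :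
    q ∈ unjoined B p ↔ q ≠ p ∧ ∀ L ∈ B, p ∈ L → q ∉ L := by
  simp [unjoined]

theorem unjoined_symm {p q : V} : q ∈ unjoined B p ↔ p ∈ unjoined B q := by
  rw [mem_unjoined, mem_unjoined, ne_comm]
  exact and_congr_right fun _ => forall₂_congr fun L _ => ⟨fun h h1 h2 => h h2 h1, fun h h1 h2 => h h2 h1⟩

theorem self_notMem_unjoined {p : V} : p ∉ unjoined B p := by
  simp [mem_unjoined]

theorem unjoined_inter_eq_empty {p : V} {L : Finset V} (hL : L ∈ B) (hp : p ∈ L) :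
    L ∩ unjoined B p = ∅ := by
  ext x
  rw [Finset.mem_inter, mem_unjoined]
  exact ⟨fun h => absurd h.1 (h.2.2 L hL hp), fun h => absurd h (Finset.notMem_empty x)⟩

/-- The points of a line off `p` that are not joined to `p`. -/
theorem card_line_inter_unjoined (hB : IsDualLinearSpace n B) {p : V} {L : Finset V} (hL : L ∈ B)
    (hp : p ∉ L) : (L ∩ unjoined B p).card + valency B p = n + 1 := by
  have h := hB.card_eq_add_sum hp
  rw [hB.card_line L hL] at h
  rw [h, valency, Finset.card_eq_sum_ones (B.filter _)]
  congr 1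
  refine Finset.sum_congr rfl fun M hM => ?_
  rw [Finset.mem_filter] at hM
  exact (hB.meet M hM.1 L hL (by rintro rfl; exact hp hM.2)).symm

theorem card_unjoined (hB : IsDualLinearSpace n B) (hV : Fintype.card V = n ^ 2 + n + 1) (p : V) :
    (unjoined B p).card + n * valency B p = n ^ 2 + n := by
  have h := hB.card_eq_add_sum (Finset.notMem_erase p Finset.univ)
  rw [Finset.card_erase_of_mem (Finset.mem_univ p), Finset.card_univ, hV,
    Finset.sum_congr rfl (g := fun _ => n)] at h
  · rw [Finset.sum_const, smul_eq_mul, Finset.erase_inter, Finset.univ_inter,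
      Finset.erase_eq_of_notMem self_notMem_unjoined] at h
    rw [valency]
    linarith [h, mul_comm n (B.filter (fun L => p ∈ L)).card, Nat.add_sub_cancel (n ^ 2 + n) 1]
  · intro M hM
    rw [Finset.mem_filter] at hM
    rw [Finset.inter_erase, Finset.inter_univ, Finset.card_erase_of_mem hM.2,
      hB.card_line M hM.1, Nat.add_sub_cancel]

theorem valency_le (hB : IsDualLinearSpace n B) (hV : Fintype.card V = n ^ 2 + n + 1)
    (hn : 1 ≤ n) (p : V) : valency B p ≤ n + 1 := by
  have := hB.card_unjoined hV p
  nlinarith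

end IsDualLinearSpace

/-! ### Deficiencies. -/

/-- The number of lines that are missing at `p`. -/
def deficiency {V : Type*} [DecidableEq V] (n : ℕ) (B : Finset (Finset V)) (p : V) : ℤ :=
  n + 1 - valency B p

namespace IsDualLinearSpace

variable {V : Type*} [DecidableEq V] {n : ℕ} {B : Finset (Finset V)}

theorem sum_deficiency_line (hB : IsDualLinearSpace n B) {E : ℤ} (hE : (B.card : ℤ) = n ^ 2 - E)
    {L : Finset V} (hL : L ∈ B) : ∑ p ∈ L, deficiency n B p = n + 1 + E := by
  have h := hB.sum_valency_line hL
  zify at h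
  unfold deficiency
  rw [Finset.sum_sub_distrib, h, Finset.sum_const, hB.card_line L hL, hE, nsmul_eq_mul]
  push_cast
  ring

theorem card_filter_notMem (p : V) :
    ((B.filter (fun L => p ∉ L)).card : ℤ) = B.card - valency B p := by
  have := Finset.card_filter_add_card_filter_not (s := B) (fun L => p ∈ L)
  unfold valency
  omega

variable [Fintype V]

theorem deficiency_eq_card_inter (hB : IsDualLinearSpace n B) {p : V} {L : Finset V} (hL : L ∈ B)
    (hp : p ∉ L) : ((L ∩ unjoined B p).card : ℤ) = deficiency n B p := by
  have := hB.card_line_inter_unjoined hL hp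
  unfold deficiency
  omega

theorem card_unjoined_eq (hB : IsDualLinearSpace n B) (hV : Fintype.card V = n ^ 2 + n + 1)
    (p : V) : ((unjoined B p).card : ℤ) = n * deficiency n B p := by
  have := hB.card_unjoined hV p
  unfold deficiency
  zify at this
  linarith

theorem deficiency_nonneg (hB : IsDualLinearSpace n B) (hV : Fintype.card V = n ^ 2 + n + 1)
    (hn : 1 ≤ n) (p : V) : 0 ≤ deficiency n B p := by
  have := hB.valency_le hV hn p
  unfold deficiency
  omega

theorem deficiency_pos (hB : IsDualLinearSpace n B) (hV : Fintype.card V = n ^ 2 + n + 1)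
    (hn : 1 ≤ n) {p q : V} (hq : q ∈ unjoined B p) : 1 ≤ deficiency n B q := by
  have h := hB.deficiency_nonneg hV hn q
  have h1 := hB.card_unjoined_eq hV q
  have h2 : 0 < (unjoined B q).card := Finset.card_pos.2 ⟨p, unjoined_symm.1 hq⟩
  rcases h.eq_or_lt with h3 | h3
  · rw [← h3] at h1
    omega
  · exact h3

theorem sum_deficiency (hB : IsDualLinearSpace n B) (hV : Fintype.card V = n ^ 2 + n + 1)
    {E : ℤ} (hE : (B.card : ℤ) = n ^ 2 - E) :
    ∑ p, deficiency n B p = (n + 1) * (n + 1 + E) := by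
  have h := hB.sum_valency_univ
  zify at h
  unfold deficiency
  rw [Finset.sum_sub_distrib, h, Finset.sum_const, Finset.card_univ, hV, hE, nsmul_eq_mul]
  push_cast
  ring

/-- Among integers, `d (d - 2)` is negative only at `d = 1`, so the sign of this sum detects points
at which exactly one line is missing. -/
theorem sum_deficiency_mul_sub_two (hB : IsDualLinearSpace n B)
    (hV : Fintype.card V = n ^ 2 + n + 1) {E : ℤ} (hE : (B.card : ℤ) = n ^ 2 - E) :
    ∑ p, deficiency n B p * (deficiency n B p - 2) = (n + 1 + E) * (E - 1) := by
  have h := hB.sum_valency_univ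
  zify at h
  have h2 := hB.sum_valency_sq
  have h3 : ∀ p, deficiency n B p * (deficiency n B p - 2) =
      ((n : ℤ) ^ 2 - 1) + (valency B p : ℤ) ^ 2 - 2 * n * valency B p := by
    intro p
    unfold deficiency
    ring
  simp_rw [h3]
  rw [Finset.sum_sub_distrib, Finset.sum_add_distrib, ← Finset.mul_sum, h, h2, Finset.sum_const,
    Finset.card_univ, hV, hE, nsmul_eq_mul]
  push_cast
  ring

/-- Lines through `p` avoid the unjoined set, and every other line meets it in `d(p)` points; count
incidences. -/
theorem sum_deficiency_unjoined (hB : IsDualLinearSpace n B)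
    (hV : Fintype.card V = n ^ 2 + n + 1) {E : ℤ} (hE : (B.card : ℤ) = n ^ 2 - E) (p : V) :
    ∑ q ∈ unjoined B p, deficiency n B q
      = deficiency n B p * (2 * n + 1 + E - deficiency n B p) := by
  have h1 : (∑ q ∈ unjoined B p, (valency B q : ℤ)) = (B.card - valency B p) * deficiency n B p := by
    have h := sum_valency B (unjoined B p)
    rw [← Finset.sum_filter_add_sum_filter_not B (fun L => p ∈ L)] at h
    rw [Finset.sum_eq_zero (s := B.filter (fun L => p ∈ L)), zero_add] at h
    · zify at h
      rw [h, Finset.sum_congr rfl (g := fun _ => deficiency n B p), Finset.sum_const,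
        nsmul_eq_mul, card_filter_notMem]
      intro M hM
      rw [Finset.mem_filter] at hM
      exact hB.deficiency_eq_card_inter hM.1 hM.2
    · intro M hM
      rw [Finset.mem_filter] at hM
      rw [unjoined_inter_eq_empty hM.1 hM.2, Finset.card_empty]
  have h2 : ∑ q ∈ unjoined B p, deficiency n B q
      = (n + 1) * (unjoined B p).card - ∑ q ∈ unjoined B p, (valency B q : ℤ) := by
    unfold deficiency
    rw [Finset.sum_sub_distrib, Finset.sum_const, nsmul_eq_mul]
    ring
  rw [h2, h1, hB.card_unjoined_eq hV, hE]
  unfold deficiency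
  ring

/-- Of the `n d(p)` points unjoined to `p`, each of the `n - d(q)` lines through `q` other than `L`
contains `d(p)`, and `L` contains none. The points left over are those unjoined to `q` as well. -/
theorem card_unjoined_inter_unjoined (hB : IsDualLinearSpace n B)
    (hV : Fintype.card V = n ^ 2 + n + 1) {p q : V} {L : Finset V} (hL : L ∈ B) (hpq : p ≠ q)
    (hp : p ∈ L) (hq : q ∈ L) :
    ((unjoined B p ∩ unjoined B q).card : ℤ) = deficiency n B p * deficiency n B q := by
  have hqp : q ∉ unjoined B p := fun h => (mem_unjoined.1 h).2 L hL hp hq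
  have h := hB.card_eq_add_sum hqp
  have hLq : L ∈ B.filter (fun L => q ∈ L) := Finset.mem_filter.2 ⟨hL, hq⟩
  rw [← Finset.add_sum_erase _ _ hLq, unjoined_inter_eq_empty hL hp, Finset.card_empty,
    zero_add] at h
  zify at h
  rw [Finset.sum_congr rfl (g := fun _ => deficiency n B p), Finset.sum_const, nsmul_eq_mul,
    Finset.card_erase_of_mem hLq, hB.card_unjoined_eq hV] at h
  · have h1 : 1 ≤ (B.filter (fun L => q ∈ L)).card := Finset.card_pos.2 ⟨L, hLq⟩
    rw [Nat.cast_sub h1] at h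
    have h2 : deficiency n B q = n + 1 - ((B.filter (fun L => q ∈ L)).card : ℤ) := rfl
    rw [h2]
    push_cast at h
    linarith
  · intro M hM
    rw [Finset.mem_erase, Finset.mem_filter] at hM
    refine hB.deficiency_eq_card_inter hM.2.1 fun hpM => hM.1 ?_
    exact hB.line_eq hM.2.1 hL hpq hpM hM.2.2 hp hq

/-- A missing line through `p` is `p` plus points unjoined to `p`; lines through `p` meet it in `p`
only, so just the lines off `p` need checking. -/
theorem card_inter_insert_eq_one {p : V} {K : Finset V} (hK : K ⊆ unjoined B p)
    (h : ∀ M ∈ B, p ∉ M → (M ∩ K).card = 1) : ∀ M ∈ B, (M ∩ insert p K).card = 1 := by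
  intro M hM
  by_cases hp : p ∈ M
  · rw [Finset.inter_insert_of_mem hp, Finset.card_eq_one]
    refine ⟨p, ?_⟩
    have : M ∩ K = ∅ := by
      rw [← Finset.subset_empty, ← unjoined_inter_eq_empty hM hp]
      exact Finset.inter_subset_inter_left hK
    rw [this]
    rfl
  · rw [Finset.inter_insert_of_notMem hp]
    exact h M hM hp

/-- A point at which exactly one line is missing determines that line. -/
theorem exists_transversal_of_deficiency_eq_one (hB : IsDualLinearSpace n B)
    (hV : Fintype.card V = n ^ 2 + n + 1) {p : V} (hp : deficiency n B p = 1) :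
    ∃ T : Finset V, p ∈ T ∧ T.card = n + 1 ∧ ∀ M ∈ B, (M ∩ T).card = 1 := by
  refine ⟨insert p (unjoined B p), Finset.mem_insert_self _ _, ?_,
    card_inter_insert_eq_one subset_rfl ?_⟩
  · rw [Finset.card_insert_of_notMem self_notMem_unjoined]
    have := hB.card_unjoined_eq hV p
    rw [hp] at this
    omega
  · intro M hM hpM
    have := hB.deficiency_eq_card_inter hM hpM
    rw [hp] at this
    exact_mod_cast this

end IsDualLinearSpace

/-! ### A stability lemma for nearly triangle-free graphs. -/

/-- An almost regular graph on `2 * n` vertices with almost no triangles is almost bipartite. The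
neighbours of `x` are `J x`, their number is `n - 1 - ε x`. -/
theorem exists_bipartition {V : Type*} [DecidableEq V] {n E : ℤ} {G : Finset V}
    {J : V → Finset V} {ε : V → ℤ} (hG : (G.card : ℤ) = 2 * n) (hJ : ∀ x ∈ G, J x ⊆ G)
    (hsymm : ∀ x ∈ G, ∀ y ∈ G, y ∈ J x → x ∈ J y) (hirr : ∀ x, x ∉ J x)
    (hcard : ∀ x ∈ G, ((J x).card : ℤ) = n - 1 - ε x) (hε : ∀ x ∈ G, 0 ≤ ε x)
    (hεE : ∀ x ∈ G, ε x ≤ E - 1) (hsum : ∑ x ∈ G, ε x = 2 * (E - 1))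
    (htri : ∀ x ∈ G, ∀ y ∈ G, ∀ z ∈ G, y ∈ J x → z ∈ J x → z ∈ J y →
      n ≤ 6 + 3 * (ε x + ε y + ε z) + (ε x * ε y + ε x * ε z + ε y * ε z))
    (hE : 1 ≤ E) (hn : 5 * E + 2 ≤ n) (hn' : E ^ 2 + 10 * E + 13 < 4 * n) :
    ((G.filter (fun x => ε x ≠ 0)).card : ℤ) ≤ 2 * (E - 1) ∧
    ∃ K₁ K₂ : Finset V, K₁ ∪ K₂ = G ∧ Disjoint K₁ K₂ ∧
      (∀ x ∈ K₁, ∀ y ∈ K₁, y ∈ J x → E ≤ ε x + ε y) ∧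
      (∀ x ∈ K₂, ∀ y ∈ K₂, y ∈ J x → E ≤ ε x + ε y) := by
  set W := G.filter (fun x => ε x ≠ 0) with hW
  have hk : (W.card : ℤ) ≤ 2 * (E - 1) := by
    rw [← hsum, Finset.card_eq_sum_ones, Nat.cast_sum]
    calc ∑ x ∈ W, ((1 : ℕ) : ℤ) ≤ ∑ x ∈ W, ε x := by
          refine Finset.sum_le_sum fun x hx => ?_
          have h1 := (Finset.mem_filter.1 hx)
          have h2 := hε x h1.1
          push_cast
          omega
      _ ≤ ∑ x ∈ G, ε x :=
          Finset.sum_le_sum_of_subset_of_nonneg (Finset.filter_subset _ _) fun x hx _ => hε x hx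
  refine ⟨hk, ?_⟩
  -- A triangle with two vertices of excess `0` would give `n ≤ 6 + 3 (E - 1)`, which is below `5 E
  -- + 2`.
  have hT : ∀ x ∈ G, ∀ y ∈ J x, ∀ z ∈ J x, ε y = 0 → ε z = 0 → z ∉ J y := by
    intro x hx y hy z hz h1 h2 h3
    have h4 := htri x hx y (hJ x hx hy) z (hJ x hx hz) hy hz h3
    rw [h1, h2] at h4
    have := hεE x hx
    linarith
  have hbig : ∀ S : Finset V, S ⊆ G → (S.card : ℤ) - W.card ≤ (S \ W).card := by
    intro S _
    have := Finset.card_le_card_sdiff_add_card (s := S) (t := W)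
    omega
  have hmemW : ∀ x ∈ G, x ∉ W → ε x = 0 := by
    intro x hx h
    by_contra h1
    exact h (Finset.mem_filter.2 ⟨hx, h1⟩)
  obtain ⟨q₁, hq₁⟩ : (G \ W).Nonempty := by
    rw [← Finset.card_pos]
    have := hbig G subset_rfl
    omega
  rw [Finset.mem_sdiff] at hq₁
  have hε₁ := hmemW q₁ hq₁.1 hq₁.2
  obtain ⟨q₂, hq₂⟩ : (J q₁ \ W).Nonempty := by
    rw [← Finset.card_pos]
    have h1 := hbig (J q₁) (hJ q₁ hq₁.1)
    have h2 := hcard q₁ hq₁.1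
    omega
  rw [Finset.mem_sdiff] at hq₂
  have hq₂G := hJ q₁ hq₁.1 hq₂.1
  have hε₂ := hmemW q₂ hq₂G hq₂.2
  have hq₁₂ := hsymm q₁ hq₁.1 q₂ hq₂G hq₂.1
  have hdisj : ∀ w ∈ J q₁, w ∉ J q₂ := by
    intro w hw hw'
    have hwG := hJ q₁ hq₁.1 hw
    exact hT w hwG q₁ (hsymm _ hq₁.1 _ hwG hw) q₂ (hsymm _ hq₂G _ hwG hw') hε₁ hε₂ hq₂.1
  set Y₁ := J q₂ \ W with hY₁
  set Y₂ := J q₁ \ W with hY₂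
  have hY₁G : Y₁ ⊆ G := Finset.sdiff_subset.trans (hJ _ hq₂G)
  have hY₂G : Y₂ ⊆ G := Finset.sdiff_subset.trans (hJ _ hq₁.1)
  have hY₁c : n - 1 - W.card ≤ Y₁.card := by
    have := hbig (J q₂) (hJ _ hq₂G)
    rw [hcard q₂ hq₂G, hε₂] at this
    linarith
  have hY₂c : n - 1 - W.card ≤ Y₂.card := by
    have := hbig (J q₁) (hJ _ hq₁.1)
    rw [hcard q₁ hq₁.1, hε₁] at this
    linarith
  have hrest : ((G \ (Y₁ ∪ Y₂)).card : ℤ) ≤ 2 + W.card := by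
    have h1 : G \ (Y₁ ∪ Y₂) ⊆ (G \ (J q₁ ∪ J q₂)) ∪ W := by
      intro x hx
      simp only [hY₁, hY₂, Finset.mem_sdiff, Finset.mem_union] at hx ⊢
      tauto
    have h2 := (Finset.card_le_card h1).trans (Finset.card_union_le _ _)
    have h3 := Finset.card_sdiff_add_card_eq_card
      (Finset.union_subset (hJ _ hq₁.1) (hJ _ hq₂G))
    have h4 := Finset.card_union_of_disjoint (Finset.disjoint_left.2 hdisj)
    have h5 := hcard q₁ hq₁.1
    have h6 := hcard q₂ hq₂G
    omega
  have hZ₁ : ∀ x ∈ Y₁, ε x = 0 := fun x hx => hmemW x (hY₁G hx) (Finset.mem_sdiff.1 hx).2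
  have hZ₂ : ∀ x ∈ Y₂, ε x = 0 := fun x hx => hmemW x (hY₂G hx) (Finset.mem_sdiff.1 hx).2
  have hI₁ : ∀ x ∈ Y₁, ∀ y ∈ Y₁, y ∉ J x := fun x hx y hy =>
    hT q₂ hq₂G x (Finset.mem_sdiff.1 hx).1 y (Finset.mem_sdiff.1 hy).1 (hZ₁ x hx) (hZ₁ y hy)
  have hI₂ : ∀ x ∈ Y₂, ∀ y ∈ Y₂, y ∉ J x := fun x hx y hy =>
    hT q₁ hq₁.1 x (Finset.mem_sdiff.1 hx).1 y (Finset.mem_sdiff.1 hy).1 (hZ₂ x hx) (hZ₂ y hy)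
  have hA : ∀ Y Y' : Finset V, Y ⊆ G → G \ (Y ∪ Y') = G \ (Y₁ ∪ Y₂) → (∀ x ∈ Y, ε x = 0) →
      (∀ x ∈ Y, ∀ y ∈ Y, y ∉ J x) → ∀ y ∈ Y, n - 3 - W.card ≤ (J y ∩ Y').card := by
    intro Y Y' hY hYY hZ hI y hy
    have h1 : J y \ Y' ⊆ G \ (Y ∪ Y') := by
      intro x hx
      simp only [Finset.mem_sdiff, Finset.mem_union] at hx ⊢
      exact ⟨hJ y (hY hy) hx.1, fun h => h.elim (fun h => hI y hy x h hx.1) hx.2⟩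
    have h2 := Finset.card_le_card h1
    have h3 := Finset.card_sdiff_add_card_inter (J y) Y'
    have h4 := hcard y (hY hy)
    rw [hZ y hy] at h4
    rw [hYY] at h2
    omega
  -- Otherwise the neighbourhoods of `x`, of `y₁` in `Y₂` and of `y₂` in `Y₁` are disjoint and miss
  -- `x`. They are too large for `2 n` vertices unless `n ≤ 6 + (E - 1) + 4 (E - 1) = 5 E + 1`; this
  -- fixes the bound `5 E + 2 ≤ n`.
  have hclaim : ∀ x ∈ G, ∀ y₁ ∈ Y₁, ∀ y₂ ∈ Y₂, y₁ ∈ J x → y₂ ∈ J x → False := by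
    intro x hx y₁ hy₁ y₂ hy₂ hx₁ hx₂
    have hc₁ := hA Y₁ Y₂ hY₁G rfl hZ₁ hI₁ y₁ hy₁
    have hc₂ := hA Y₂ Y₁ hY₂G (by rw [Finset.union_comm]) hZ₂ hI₂ y₂ hy₂
    have hc := hcard x hx
    have hd₁ : Disjoint (J x) (J y₁ ∩ Y₂) := by
      rw [Finset.disjoint_left]
      intro w hw hw'
      rw [Finset.mem_inter] at hw'
      exact hT x hx y₁ hx₁ w hw (hZ₁ y₁ hy₁) (hZ₂ w hw'.2) hw'.1
    have hd₂ : Disjoint (J x ∪ (J y₁ ∩ Y₂)) (J y₂ ∩ Y₁) := by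
      rw [Finset.disjoint_left]
      intro w hw hw'
      rw [Finset.mem_inter] at hw'
      rcases Finset.mem_union.1 hw with hw | hw
      · exact hT x hx y₂ hx₂ w hw (hZ₂ y₂ hy₂) (hZ₁ w hw'.2) hw'.1
      · exact hdisj w (Finset.mem_sdiff.1 (Finset.mem_inter.1 hw).2).1
          (Finset.mem_sdiff.1 hw'.2).1
    have hsub : J x ∪ (J y₁ ∩ Y₂) ∪ (J y₂ ∩ Y₁) ⊆ G.erase x := by
      intro w hw
      simp only [Finset.mem_union, Finset.mem_inter] at hw
      rw [Finset.mem_erase]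
      rcases hw with (hw | hw) | hw
      · exact ⟨fun h => hirr x (h ▸ hw), hJ x hx hw⟩
      · exact ⟨fun h => hI₂ w hw.2 y₂ hy₂ (h ▸ hx₂), hY₂G hw.2⟩
      · exact ⟨fun h => hI₁ w hw.2 y₁ hy₁ (h ▸ hx₁), hY₁G hw.2⟩
    have h1 := Finset.card_le_card hsub
    rw [Finset.card_union_of_disjoint hd₂, Finset.card_union_of_disjoint hd₁] at h1
    have h2 := Finset.card_erase_add_one hx
    have h3 := hεE x hx
    omega
  -- Both neighbourhoods lie in `G \ Y`, which has little more than `n` vertices, so they overlap in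
  -- a vertex `z` of excess `0`, and `x`, `y`, `z` form a triangle.
  have hside : ∀ Y : Finset V, Y ⊆ G → n - 1 - W.card ≤ Y.card → ∀ x ∈ G, ∀ y ∈ G,
      Disjoint (J x) Y → Disjoint (J y) Y → y ∈ J x → E ≤ ε x + ε y := by
    intro Y hY hYc x hx y hy hxY hyY hxy
    by_contra hlt
    push Not at hlt
    have h1 : J x ∪ J y ⊆ G \ Y := by
      intro w hw
      rw [Finset.mem_sdiff]
      rcases Finset.mem_union.1 hw with hw | hw
      · exact ⟨hJ x hx hw, Finset.disjoint_left.1 hxY hw⟩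
      · exact ⟨hJ y hy hw, Finset.disjoint_left.1 hyY hw⟩
    have h2 := Finset.card_le_card h1
    have h3 := Finset.card_sdiff_add_card_eq_card hY
    have h4 := Finset.card_union_add_card_inter (J x) (J y)
    have h5 := hcard x hx
    have h6 := hcard y hy
    obtain ⟨z, hz⟩ : ((J x ∩ J y) \ W).Nonempty := by
      rw [← Finset.card_pos]
      have := hbig (J x ∩ J y) (Finset.inter_subset_left.trans (hJ x hx))
      omega
    rw [Finset.mem_sdiff, Finset.mem_inter] at hz
    have hzG := hJ x hx hz.1.1
    have h7 := htri x hx y hy z hzG hxy hz.1.1 hz.1.2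
    rw [hmemW z hzG hz.2] at h7
    have h8 := hε x hx
    have h9 := hε y hy
    -- If the excesses of `x` and `y` add up to at most `E - 1`, their product is at most `(E - 1) ^
    -- 2 / 4`, and the triangle bound becomes `4 n ≤ E ^ 2 + 10 E + 13`.
    nlinarith [sq_nonneg (ε x - ε y), mul_nonneg (add_nonneg h8 h9) (by linarith : 0 ≤ E - 1 - (ε x + ε y)),
      mul_nonneg (by linarith : 0 ≤ E - 1) (by linarith : 0 ≤ E - 1 - (ε x + ε y))]
  refine ⟨G.filter (fun x => Disjoint (J x) Y₁), G.filter (fun x => ¬ Disjoint (J x) Y₁),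
    Finset.filter_union_filter_not_eq _ _, Finset.disjoint_filter_filter_not _ _ _, ?_, ?_⟩
  · intro x hx y hy
    rw [Finset.mem_filter] at hx hy
    exact hside Y₁ hY₁G hY₁c x hx.1 y hy.1 hx.2 hy.2
  · have h : ∀ x ∈ G, ¬ Disjoint (J x) Y₁ → Disjoint (J x) Y₂ := by
      intro x hx h
      obtain ⟨y₁, h1, h2⟩ := Finset.not_disjoint_iff.1 h
      rw [Finset.disjoint_left]
      exact fun y₂ h3 h4 => hclaim x hx y₁ h2 y₂ h4 h1 h3
    intro x hx y hy
    rw [Finset.mem_filter] at hx hy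
    exact hside Y₂ hY₂G hY₂c x hx.1 y hy.1 (h x hx.1 hx.2) (h y hy.1 hy.2)

/-! ### Points at which exactly two lines are missing. -/

/-- A point `p` at which two lines are missing, in a dual linear space with `n ^ 2 - E` lines that
has no point at which exactly one line is missing. -/
structure IsDoublePoint {V : Type*} [DecidableEq V] [Fintype V] (n : ℕ) (B : Finset (Finset V))
    (E : ℤ) (p : V) : Prop where
  dual : IsDualLinearSpace n B
  card_points : Fintype.card V = n ^ 2 + n + 1
  card_lines : (B.card : ℤ) = n ^ 2 - E
  deficiency_eq : deficiency n B p = 2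
  ne_one : ∀ q, deficiency n B q ≠ 1
  one_le : 1 ≤ E
  large : 5 * E + 2 ≤ n
  large' : E ^ 2 + 10 * E + 13 < 4 * n

namespace IsDoublePoint

open IsDualLinearSpace

variable {V : Type*} [DecidableEq V] [Fintype V] {n : ℕ} {B : Finset (Finset V)} {E : ℤ} {p : V}

theorem one_le_order (h : IsDoublePoint n B E p) : 1 ≤ n := by
  have := h.large
  have := h.one_le
  omega

theorem two_le (h : IsDoublePoint n B E p) {x y : V} (hy : y ∈ unjoined B x) :
    2 ≤ deficiency n B y := by
  have h1 := h.dual.deficiency_pos h.card_points h.one_le_order hy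
  have h2 := h.ne_one y
  omega

theorem card_unjoined (h : IsDoublePoint n B E p) : ((unjoined B p).card : ℤ) = 2 * n := by
  rw [h.dual.card_unjoined_eq h.card_points, h.deficiency_eq, mul_comm]

theorem sum_excess (h : IsDoublePoint n B E p) :
    ∑ q ∈ unjoined B p, (deficiency n B q - 2) = 2 * (E - 1) := by
  rw [Finset.sum_sub_distrib, h.dual.sum_deficiency_unjoined h.card_points h.card_lines,
    Finset.sum_const, nsmul_eq_mul, h.card_unjoined, h.deficiency_eq]
  ring

/-- All `n d(x)` points unjoined to `x` have deficiency at least `2`; compare with the exact sum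
`d(x) (2 n + 1 + E - d(x))`. -/
theorem deficiency_le (h : IsDoublePoint n B E p) {x : V} (hx : x ∈ unjoined B p) :
    deficiency n B x - 2 ≤ E - 1 := by
  have h1 := h.dual.sum_deficiency_unjoined h.card_points h.card_lines x
  have h2 : (unjoined B x).card • (2 : ℤ) ≤ ∑ q ∈ unjoined B x, deficiency n B q :=
    Finset.card_nsmul_le_sum _ _ _ fun q hq => h.two_le hq
  rw [h1, nsmul_eq_mul, h.dual.card_unjoined_eq h.card_points] at h2
  have h3 := h.two_le hx
  by_contra h4
  nlinarith [mul_pos (by linarith : 0 < deficiency n B x)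
    (by linarith : 0 < deficiency n B x - 1 - E)]

/-- Each line through `x` misses `p`, so it contains two points unjoined to `p`: `x` and one other.
The count is therefore the valency of `x`. -/
theorem card_joined (h : IsDoublePoint n B E p) {x : V} (hx : x ∈ unjoined B p) :
    ((((unjoined B p).erase x) \ unjoined B x).card : ℤ) = n - 1 - (deficiency n B x - 2) := by
  have h1 := h.dual.card_eq_add_sum (Finset.notMem_erase x (unjoined B p))
  rw [Finset.sum_congr rfl (g := fun _ => 1), ← Finset.card_eq_sum_ones] at h1
  · have h2 := Finset.card_sdiff_add_card_inter ((unjoined B p).erase x) (unjoined B x)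
    unfold deficiency valency
    omega
  · intro L hL
    rw [Finset.mem_filter] at hL
    have hpL : p ∉ L := fun hp => (mem_unjoined.1 hx).2 L hL.1 hp hL.2
    have h2 := h.dual.deficiency_eq_card_inter hL.1 hpL
    rw [h.deficiency_eq] at h2
    rw [Finset.inter_erase, Finset.card_erase_of_mem (Finset.mem_inter.2 ⟨hL.2, hx⟩)]
    omega

theorem mem_joined {x y : V} :
    y ∈ ((unjoined B p).erase x) \ unjoined B x ↔
      y ≠ x ∧ y ∈ unjoined B p ∧ ∃ L ∈ B, x ∈ L ∧ y ∈ L := by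
  rw [Finset.mem_sdiff, Finset.mem_erase, mem_unjoined (p := x)]
  push Not
  exact ⟨fun h => ⟨h.1.1, h.1.2, h.2 h.1.1⟩, fun h => ⟨⟨h.1, h.2.1⟩, fun _ => h.2.2⟩⟩

/-- Three mutually joined points that are not joined to `p` have large deficiencies. -/
theorem le_of_triangle (h : IsDoublePoint n B E p) {x y z : V} (hx : x ∈ unjoined B p)
    (hy : y ∈ unjoined B p) (hz : z ∈ unjoined B p)
    (hxy : y ∈ ((unjoined B p).erase x) \ unjoined B x)
    (hxz : z ∈ ((unjoined B p).erase x) \ unjoined B x)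
    (hyz : z ∈ ((unjoined B p).erase y) \ unjoined B y) {a b c : ℤ}
    (ha : deficiency n B x - 2 = a) (hb : deficiency n B y - 2 = b)
    (hc : deficiency n B z - 2 = c) :
    (n : ℤ) ≤ 6 + 3 * (a + b + c) + (a * b + a * c + b * c) := by
  have hA : ∀ w ∈ unjoined B p, ((unjoined B p ∩ unjoined B w).card : ℤ) =
      n + (deficiency n B w - 2) := by
    intro w hw
    have h1 := h.card_joined hw
    have h2 := Finset.card_sdiff_add_card_inter ((unjoined B p).erase w) (unjoined B w)
    have h3 := Finset.card_erase_add_one hw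
    have h4 := h.card_unjoined
    rw [Finset.erase_inter, Finset.erase_eq_of_notMem
      (fun h => self_notMem_unjoined (Finset.mem_inter.1 h).2)] at h2
    omega
  -- The extra `1` is `p`, which is unjoined to both `v` and `w` but does not lie in its own
  -- unjoined set.
  have hI : ∀ v ∈ unjoined B p, ∀ w ∈ unjoined B p,
      w ∈ ((unjoined B p).erase v) \ unjoined B v →
      ((unjoined B p ∩ unjoined B v ∩ (unjoined B p ∩ unjoined B w)).card : ℤ) + 1 ≤
        deficiency n B v * deficiency n B w := by
    intro v hv w hw hvw
    obtain ⟨h1, -, L, hL, hvL, hwL⟩ := mem_joined.1 hvw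
    rw [← h.dual.card_unjoined_inter_unjoined h.card_points hL h1.symm hvL hwL]
    have h2 : insert p (unjoined B p ∩ unjoined B v ∩ (unjoined B p ∩ unjoined B w)) ⊆
        unjoined B v ∩ unjoined B w := by
      intro u hu
      rcases Finset.mem_insert.1 hu with rfl | hu
      · exact Finset.mem_inter.2 ⟨unjoined_symm.1 hv, unjoined_symm.1 hw⟩
      · simp only [Finset.mem_inter] at hu ⊢
        exact ⟨hu.1.2, hu.2.2⟩
    have h3 := Finset.card_le_card h2
    rw [Finset.card_insert_of_notMem (by simp [self_notMem_unjoined])] at h3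
    exact_mod_cast h3
  have hyx := (mem_joined.1 hxy)
  have hzx := (mem_joined.1 hxz)
  have hzy := (mem_joined.1 hyz)
  -- The three sets of about `n` points, with small pairwise intersections, must fit into the `2 n -
  -- 3` points unjoined to `p` other than `x`, `y`, `z`. Inclusion-exclusion then gives the bound.
  have hsub : (unjoined B p ∩ unjoined B x) ∪ (unjoined B p ∩ unjoined B y) ∪
      (unjoined B p ∩ unjoined B z) ⊆ ((unjoined B p) \ {x, y, z}) := by
    have key : ∀ u v, (v ≠ u ∧ ∃ L ∈ B, u ∈ L ∧ v ∈ L) →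
        v ∉ unjoined B u ∧ u ∉ unjoined B v := by
      rintro u v ⟨-, L, hL, huL, hvL⟩
      exact ⟨fun h => (mem_unjoined.1 h).2 L hL huL hvL,
        fun h => (mem_unjoined.1 h).2 L hL hvL huL⟩
    have k1 := key x y ⟨hyx.1, hyx.2.2⟩
    have k2 := key x z ⟨hzx.1, hzx.2.2⟩
    have k3 := key y z ⟨hzy.1, hzy.2.2⟩
    have s1 := self_notMem_unjoined (B := B) (p := x)
    have s2 := self_notMem_unjoined (B := B) (p := y)
    have s3 := self_notMem_unjoined (B := B) (p := z)
    intro u hu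
    simp only [Finset.mem_union, Finset.mem_inter] at hu
    simp only [Finset.mem_sdiff, Finset.mem_insert, Finset.mem_singleton, not_or]
    refine ⟨by tauto, ?_, ?_, ?_⟩ <;> rintro rfl <;> tauto
  have h1 := Finset.card_le_card hsub
  have h2 : ({x, y, z} : Finset V).card = 3 :=
    Finset.card_eq_three.2 ⟨x, y, z, hyx.1.symm, hzx.1.symm, hzy.1.symm, rfl⟩
  have h3 := Finset.card_sdiff_add_card_eq_card (s := {x, y, z}) (t := unjoined B p) (by
    intro u hu
    simp only [Finset.mem_insert, Finset.mem_singleton] at hu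
    rcases hu with rfl | rfl | rfl <;> assumption)
  have h4 := h.card_unjoined
  have h5 := Finset.card_union_add_card_inter (unjoined B p ∩ unjoined B x)
    (unjoined B p ∩ unjoined B y)
  have h6 := Finset.card_union_add_card_inter ((unjoined B p ∩ unjoined B x) ∪
    (unjoined B p ∩ unjoined B y)) (unjoined B p ∩ unjoined B z)
  have h7 : (((unjoined B p ∩ unjoined B x) ∪ (unjoined B p ∩ unjoined B y)) ∩
      (unjoined B p ∩ unjoined B z)).card ≤
      (unjoined B p ∩ unjoined B x ∩ (unjoined B p ∩ unjoined B z)).card +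
      (unjoined B p ∩ unjoined B y ∩ (unjoined B p ∩ unjoined B z)).card := by
    rw [Finset.union_inter_distrib_right]
    exact Finset.card_union_le _ _
  have a1 := hA x hx
  have a2 := hA y hy
  have a3 := hA z hz
  have i1 := hI x hx y hy hxy
  have i2 := hI x hx z hz hxz
  have i3 := hI y hy z hz hyz
  have hx' : deficiency n B x = a + 2 := by linarith
  have hy' : deficiency n B y = b + 2 := by linarith
  have hz' : deficiency n B z = c + 2 := by linarith
  rw [hx', hy'] at i1
  rw [hx', hz'] at i2
  rw [hy', hz'] at i3
  rw [hx'] at a1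
  rw [hy'] at a2
  rw [hz'] at a3
  zify at h1 h2 h3 h5 h6 h7
  linarith

/-- The points that are not joined to `p` split into two almost cliques. -/
theorem exists_almost_cliques (h : IsDoublePoint n B E p) :
    ((((unjoined B p).filter (fun x => deficiency n B x - 2 ≠ 0)).card : ℤ) ≤ 2 * (E - 1)) ∧
    ∃ K₁ K₂ : Finset V, K₁ ∪ K₂ = unjoined B p ∧ Disjoint K₁ K₂ ∧
      (∀ x ∈ K₁, ∀ y ∈ K₁, x ≠ y → ∀ L ∈ B, x ∈ L → y ∈ L →
        E ≤ (deficiency n B x - 2) + (deficiency n B y - 2)) ∧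
      (∀ x ∈ K₂, ∀ y ∈ K₂, x ≠ y → ∀ L ∈ B, x ∈ L → y ∈ L →
        E ≤ (deficiency n B x - 2) + (deficiency n B y - 2)) := by
  -- Adjacency means being joined by a line, so the sides of the bipartition are sets of mostly
  -- unjoined points, that is, candidates for missing lines.
  have key := exists_bipartition (n := n) (E := E) (G := unjoined B p)
    (J := fun x => ((unjoined B p).erase x) \ unjoined B x)
    (ε := fun x => deficiency n B x - 2) h.card_unjoined
    (fun x _ => Finset.sdiff_subset.trans (Finset.erase_subset _ _))
    (fun x hx y hy hxy => by
      rw [mem_joined] at hxy ⊢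
      obtain ⟨h1, -, L, hL, h2, h3⟩ := hxy
      exact ⟨h1.symm, hx, L, hL, h3, h2⟩)
    (fun x hx => (mem_joined.1 hx).1 rfl)
    (fun x hx => h.card_joined hx) (fun x hx => by linarith [h.two_le hx])
    (fun x hx => h.deficiency_le hx) h.sum_excess
    (fun x hx y hy z hz hxy hxz hyz => h.le_of_triangle hx hy hz hxy hxz hyz rfl rfl rfl)
    h.one_le h.large h.large'
  obtain ⟨hk, K₁, K₂, hK, hd, h1, h2⟩ := key
  refine ⟨hk, K₁, K₂, hK, hd, ?_, ?_⟩
  · intro x hx y hy hxy L hL hxL hyL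
    exact h1 x hx y hy (mem_joined.2 ⟨hxy.symm, hK ▸ Finset.mem_union_left _ hy, L, hL, hxL, hyL⟩)
  · intro x hx y hy hxy L hL hxL hyL
    exact h2 x hx y hy (mem_joined.2 ⟨hxy.symm, hK ▸ Finset.mem_union_right _ hy, L, hL, hxL, hyL⟩)

theorem card_inter_add_card_inter (h : IsDoublePoint n B E p) {K₁ K₂ : Finset V}
    (hK : K₁ ∪ K₂ = unjoined B p) (hd : Disjoint K₁ K₂) {M : Finset V} (hM : M ∈ B)
    (hp : p ∉ M) : (M ∩ K₁).card + (M ∩ K₂).card = 2 := by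
  have h1 := h.dual.deficiency_eq_card_inter hM hp
  rw [h.deficiency_eq, ← hK, Finset.inter_union_distrib_left, Finset.card_union_of_disjoint
    (hd.mono Finset.inter_subset_right Finset.inter_subset_right)] at h1
  exact_mod_cast h1

/-- Incidences between `K` and the lines, which only lines off `p` contribute to. -/
theorem sum_valency_subset (_h : IsDoublePoint n B E p) {K : Finset V}
    (hK : K ⊆ unjoined B p) :
    (∑ M ∈ B.filter (fun M => p ∉ M), ((M ∩ K).card : ℤ)) =
      K.card * (n - 1) - ∑ x ∈ K, (deficiency n B x - 2) := by
  have h1 := sum_valency B K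
  rw [← Finset.sum_filter_add_sum_filter_not B (fun M => p ∈ M),
    Finset.sum_eq_zero (s := B.filter (fun M => p ∈ M)), zero_add] at h1
  · zify at h1
    rw [← h1]
    unfold deficiency
    rw [Finset.sum_sub_distrib, Finset.sum_sub_distrib, Finset.sum_const, Finset.sum_const,
      nsmul_eq_mul, nsmul_eq_mul]
    ring
  · intro M hM
    rw [Finset.mem_filter] at hM
    rw [Finset.card_eq_zero, ← Finset.subset_empty, ← unjoined_inter_eq_empty hM.1 hM.2]
    exact Finset.inter_subset_inter_left hK

theorem card_lines_off (h : IsDoublePoint n B E p) :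
    ((B.filter (fun M => p ∉ M)).card : ℤ) = n * (n - 1) + 1 - E := by
  have h1 := h.deficiency_eq
  rw [card_filter_notMem, h.card_lines]
  unfold deficiency at h1
  linarith

end IsDoublePoint

namespace IsDoublePoint

open IsDualLinearSpace

variable {V : Type*} [DecidableEq V] [Fintype V] {n : ℕ} {B : Finset (Finset V)} {E : ℤ} {p : V}

theorem sum_excess_le (h : IsDoublePoint n B E p) {K S : Finset V} (hK : K ⊆ unjoined B p)
    (hS : S ⊆ K) : ∑ x ∈ S, (deficiency n B x - 2) ≤ ∑ x ∈ K, (deficiency n B x - 2) :=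
  Finset.sum_le_sum_of_subset_of_nonneg hS fun x hx _ => by linarith [h.two_le (hK hx)]

/-- The number of lines through `x` that contain a second point of `K` of deficiency at least
three. -/
theorem card_lines_through_le (h : IsDoublePoint n B E p) {S : Finset (Finset V)} (hS : S ⊆ B)
    {W : Finset V} {x : V} (hx : ∀ M ∈ S, x ∈ M ∧ ∃ y ∈ M, y ≠ x ∧ y ∈ W) :
    S.card ≤ W.card := by
  have h1 := h.dual.card_eq_add_sum (Finset.notMem_erase x W)
  have h2 : S.card ≤ ∑ L ∈ B.filter (fun L => x ∈ L), (L ∩ W.erase x).card := by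
    have h3 : S ⊆ B.filter (fun L => x ∈ L) :=
      fun M hM => Finset.mem_filter.2 ⟨hS hM, (hx M hM).1⟩
    refine le_trans ?_ (Finset.sum_le_sum_of_subset h3)
    rw [Finset.card_eq_sum_ones]
    refine Finset.sum_le_sum fun M hM => Finset.card_pos.2 ?_
    obtain ⟨-, y, hy, hyx, hyW⟩ := hx M hM
    exact ⟨y, Finset.mem_inter.2 ⟨hy, Finset.mem_erase.2 ⟨hyx, hyW⟩⟩⟩
  have h3 := Finset.card_le_card (Finset.erase_subset x W)
  omega

/-- An almost clique is a clique. -/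
theorem eq_of_mem_almost_clique (h : IsDoublePoint n B E p) {K₁ K₂ : Finset V}
    (hK : K₁ ∪ K₂ = unjoined B p) (hd : Disjoint K₁ K₂)
    (hW : ((((unjoined B p).filter (fun x => deficiency n B x - 2 ≠ 0)).card : ℤ) ≤ 2 * (E - 1)))
    (h₁ : ∀ x ∈ K₁, ∀ y ∈ K₁, x ≠ y → ∀ L ∈ B, x ∈ L → y ∈ L →
        E ≤ (deficiency n B x - 2) + (deficiency n B y - 2))
    (h₂ : ∀ x ∈ K₂, ∀ y ∈ K₂, x ≠ y → ∀ L ∈ B, x ∈ L → y ∈ L →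
        E ≤ (deficiency n B x - 2) + (deficiency n B y - 2))
    {M : Finset V} (hM : M ∈ B) {x y : V} (hxM : x ∈ M) (hyM : y ∈ M) (hx : x ∈ K₁)
    (hy : y ∈ K₁) : x = y := by
  by_contra hxy
  have hK₁ : K₁ ⊆ unjoined B p := hK ▸ Finset.subset_union_left
  have hK₂ : K₂ ⊆ unjoined B p := hK ▸ Finset.subset_union_right
  have hs : ∑ x ∈ K₁, (deficiency n B x - 2) + ∑ x ∈ K₂, (deficiency n B x - 2)
      = 2 * (E - 1) := by
    rw [← Finset.sum_union hd, hK, h.sum_excess]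
  have hpair := h₁ x hx y hy hxy M hM hxM hyM
  have hs₁ := h.sum_excess_le hK₁ (S := {x, y}) (by
    intro u hu
    rcases Finset.mem_insert.1 hu with rfl | hu
    · exact hx
    · exact Finset.mem_singleton.1 hu ▸ hy)
  rw [Finset.sum_pair hxy] at hs₁
  -- The pair `x`, `y` uses up excess `E` of the total `2 (E - 1)`. What is left for `K₂` is too
  -- little for a joined pair there, so every line off `p` has one or two points in `K₁`.
  have hs₂ : ∀ S ⊆ K₂, ∑ x ∈ S, (deficiency n B x - 2) ≤ E - 2 := fun S hS => by
    have := h.sum_excess_le hK₂ hS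
    linarith
  have hM₂ : ∀ L ∈ B, (L ∩ K₂).card ≤ 1 := by
    intro L hL
    rw [Finset.card_le_one]
    intro u hu v hv
    rw [Finset.mem_inter] at hu hv
    by_contra huv
    have h3 := h₂ u hu.2 v hv.2 huv L hL hu.1 hv.1
    have h4 := hs₂ {u, v} (by
      intro w hw
      rcases Finset.mem_insert.1 hw with rfl | hw
      · exact hu.2
      · exact Finset.mem_singleton.1 hw ▸ hv.2)
    rw [Finset.sum_pair huv] at h4
    linarith
  have hcard := fun L hL hpL => h.card_inter_add_card_inter hK hd (M := L) hL hpL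
  set S := (B.filter (fun L => p ∉ L)).filter (fun L => (L ∩ K₁).card = 2) with hS
  have hsum : (∑ L ∈ B.filter (fun L => p ∉ L), ((L ∩ K₁).card : ℤ)) =
      (B.filter (fun L => p ∉ L)).card + S.card := by
    rw [hS, Finset.card_filter (fun L => (L ∩ K₁).card = 2), Finset.card_eq_sum_ones,
      Nat.cast_sum, Nat.cast_sum, ← Finset.sum_add_distrib]
    refine Finset.sum_congr rfl fun L hL => ?_
    rw [Finset.mem_filter] at hL
    have h3 := hcard L hL.1 hL.2
    have h4 := hM₂ L hL.1
    split_ifs with h5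
    · rw [h5]; rfl
    · push_cast; omega
  have hpM : p ∉ M := fun hp => (mem_unjoined.1 (hK₁ hx)).2 M hM hp hxM
  have hMS : M ∈ S := by
    refine Finset.mem_filter.2 ⟨Finset.mem_filter.2 ⟨hM, hpM⟩, le_antisymm ?_ ?_⟩
    · have := hcard M hM hpM
      omega
    · exact Finset.one_lt_card.2 ⟨x, Finset.mem_inter.2 ⟨hxM, hx⟩, y,
        Finset.mem_inter.2 ⟨hyM, hy⟩, hxy⟩
  have hSpos : (1 : ℤ) ≤ S.card := by exact_mod_cast Finset.card_pos.2 ⟨M, hMS⟩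
  rw [h.sum_valency_subset hK₁, h.card_lines_off] at hsum
  have hE := h.one_le
  have hl := h.large
  have hs₂' := hs₂ ∅ (Finset.empty_subset _)
  rw [Finset.sum_empty] at hs₂'
  have hs₂'' := h.sum_excess_le hK₂ (Finset.empty_subset _)
  rw [Finset.sum_empty] at hs₂''
  -- One line with two points in `K₁` already forces `|K₁| ≥ n + 1`, and this surplus forces many
  -- such lines.
  have hlow : (n : ℤ) - E ≤ S.card := by
    have h3 : (n : ℤ) + 1 ≤ K₁.card := by
      by_contra h4
      have h5 : (K₁.card : ℤ) ≤ n := by omega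
      nlinarith [mul_nonneg (by linarith : (0 : ℤ) ≤ n - K₁.card) (by linarith : (0 : ℤ) ≤ n - 1)]
    nlinarith [mul_nonneg (by linarith : (0 : ℤ) ≤ K₁.card - (n + 1))
      (by linarith : (0 : ℤ) ≤ n - 1)]
  set W := (unjoined B p).filter (fun x => deficiency n B x - 2 ≠ 0)
  have hinternal : ∀ L ∈ S, ∃ u ∈ L, ∃ v ∈ L, u ≠ v ∧ u ∈ K₁ ∧ v ∈ K₁ := by
    intro L hL
    obtain ⟨u, hu, v, hv, huv⟩ := Finset.one_lt_card.1
      (lt_of_lt_of_eq one_lt_two (Finset.mem_filter.1 hL).2.symm)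
    rw [Finset.mem_inter] at hu hv
    exact ⟨u, hu.1, v, hv.1, huv, hu.2, hv.2⟩
  have hSB : S ⊆ B := (Finset.filter_subset _ _).trans (Finset.filter_subset _ _)
  -- The second point on such a line has positive excess, because `z` alone has at most `E - 1`.
  have hthrough : ∀ z ∈ K₁, ((S.filter (fun L => z ∈ L)).card : ℤ) ≤ 2 * (E - 1) := by
    intro z hz
    refine le_trans ?_ hW
    refine Int.ofNat_le.2 (h.card_lines_through_le ((Finset.filter_subset _ _).trans hSB)
      (x := z) ?_)
    intro L hL
    rw [Finset.mem_filter] at hL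
    refine ⟨hL.2, ?_⟩
    have hw : ∃ w ∈ L, w ≠ z ∧ w ∈ K₁ := by
      obtain ⟨u, hu, v, hv, huv, hu', hv'⟩ := hinternal L hL.1
      by_cases huz : u = z
      · exact ⟨v, hv, fun hvz => huv (huz.trans hvz.symm), hv'⟩
      · exact ⟨u, hu, huz, hu'⟩
    obtain ⟨w, hwL, hwz, hw⟩ := hw
    have h3 := h₁ z hz w hw hwz.symm L (hSB hL.1) hL.2 hwL
    have h4 := h.deficiency_le (hK₁ hz)
    exact ⟨w, hwL, hwz, Finset.mem_filter.2 ⟨hK₁ hw, by linarith⟩⟩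
  -- A line with two points in `K₁` and avoiding `x` and `y` would bring the excess to `2 E`. Hence
  -- `n - E ≤ |S| ≤ 4 (E - 1)`, against `5 E + 2 ≤ n`.
  have hcover : S ⊆ S.filter (fun L => x ∈ L) ∪ S.filter (fun L => y ∈ L) := by
    intro L hL
    rw [Finset.mem_union]
    by_contra hno
    have hxL : x ∉ L := fun hxL => hno (Or.inl (Finset.mem_filter.2 ⟨hL, hxL⟩))
    have hyL : y ∉ L := fun hyL => hno (Or.inr (Finset.mem_filter.2 ⟨hL, hyL⟩))
    obtain ⟨u, hu, v, hv, huv, hu', hv'⟩ := hinternal L hL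
    have h3 := h₁ u hu' v hv' huv L (hSB hL) hu hv
    have h4 := h.sum_excess_le hK₁ (S := {x, y} ∪ {u, v}) (by
      intro w hw
      simp only [Finset.mem_union, Finset.mem_insert, Finset.mem_singleton] at hw
      rcases hw with (rfl | rfl) | (rfl | rfl) <;> assumption)
    rw [Finset.sum_union, Finset.sum_pair hxy, Finset.sum_pair huv] at h4
    · linarith
    · rw [Finset.disjoint_left]
      intro w hw hw'
      simp only [Finset.mem_insert, Finset.mem_singleton] at hw hw'
      rcases hw with rfl | rfl <;> rcases hw' with rfl | rfl <;> contradiction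
  have h3 := (Finset.card_le_card hcover).trans (Finset.card_union_le _ _)
  have h4 := hthrough x hx
  have h5 := hthrough y hy
  omega

/-- Each line off `p` has two points in `K₁ ∪ K₂` and at most one in either, hence exactly one in
each, so `p` with `K₁` is a missing line. -/
theorem exists_transversal (h : IsDoublePoint n B E p) :
    ∃ T : Finset V, T.card = n + 1 ∧ ∀ M ∈ B, (M ∩ T).card = 1 := by
  obtain ⟨hW, K₁, K₂, hK, hd, h₁, h₂⟩ := h.exists_almost_cliques
  have hK₁ : K₁ ⊆ unjoined B p := hK ▸ Finset.subset_union_left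
  have hone : ∀ M ∈ B, p ∉ M → (M ∩ K₁).card = 1 := by
    intro M hM hpM
    have h3 := h.card_inter_add_card_inter hK hd hM hpM
    have h4 : (M ∩ K₁).card ≤ 1 := by
      rw [Finset.card_le_one]
      intro x hx y hy
      rw [Finset.mem_inter] at hx hy
      exact h.eq_of_mem_almost_clique hK hd hW h₁ h₂ hM hx.1 hy.1 hx.2 hy.2
    have h5 : (M ∩ K₂).card ≤ 1 := by
      rw [Finset.card_le_one]
      intro x hx y hy
      rw [Finset.mem_inter] at hx hy
      exact h.eq_of_mem_almost_clique (by rw [Finset.union_comm, hK]) hd.symm hW h₂ h₁ hM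
        hx.1 hy.1 hx.2 hy.2
    omega
  refine ⟨insert p K₁, ?_, card_inter_insert_eq_one hK₁ hone⟩
  rw [Finset.card_insert_of_notMem (fun hp => self_notMem_unjoined (hK₁ hp))]
  have h3 := h.sum_valency_subset hK₁
  rw [Finset.sum_congr rfl (g := fun _ => (1 : ℤ)), Finset.sum_const, nsmul_eq_mul, mul_one,
    h.card_lines_off] at h3
  · have h4 := h.sum_excess_le hK₁ (Finset.empty_subset _)
    have h5 := h.sum_excess_le subset_rfl hK₁
    rw [Finset.sum_empty] at h4
    rw [h.sum_excess] at h5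
    have hE := h.one_le
    have hl := h.large
    -- `|K₁| (n - 1)` differs from `n (n - 1)` by at most `E - 1`, which is less than `n - 1`.
    have h6 : (K₁.card : ℤ) = n := by
      apply le_antisymm <;> by_contra h7 <;> push Not at h7
      · nlinarith [mul_nonneg (by linarith : (0 : ℤ) ≤ K₁.card - (n + 1))
          (by linarith : (0 : ℤ) ≤ n - 1)]
      · nlinarith [mul_nonneg (by linarith : (0 : ℤ) ≤ n - 1 - K₁.card)
          (by linarith : (0 : ℤ) ≤ n - 1)]
    omega
  · intro M hM
    rw [Finset.mem_filter] at hM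
    exact_mod_cast hone M hM.1 hM.2

end IsDoublePoint

/-! ### Completion to a projective plane. -/

/-- The number `e` is small enough, compared to `n`, for a dual linear space of order `n` with
`n ^ 2 - e` lines to be completed to a projective plane. -/
def IsSmallDefect (n e : ℕ) : Prop :=
  e = 0 ∨ (5 * e + 2 ≤ n ∧ e ^ 2 + 10 * e + 13 < 4 * n) ∨ (n = 3 ∧ e = 1)

namespace IsDualLinearSpace

variable {V : Type*} [DecidableEq V] [Fintype V] {n : ℕ} {B : Finset (Finset V)}

theorem card_lines_le (hB : IsDualLinearSpace n B) (hV : Fintype.card V = n ^ 2 + n + 1)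
    (hn : 1 ≤ n) : B.card ≤ n ^ 2 + n + 1 := by
  have h1 := hB.sum_deficiency hV (E := n ^ 2 - B.card) (by ring)
  have h2 : 0 ≤ ∑ p, deficiency n B p := Finset.sum_nonneg fun p _ => hB.deficiency_nonneg hV hn p
  rw [h1] at h2
  have h3 := nonneg_of_mul_nonneg_right h2 (by positivity)
  zify
  linarith

theorem exists_transversal (hB : IsDualLinearSpace n B) (hV : Fintype.card V = n ^ 2 + n + 1)
    (hn : 1 ≤ n) {e : ℕ} (he : IsSmallDefect n e) (hcard : n ^ 2 ≤ B.card + e)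
    (hlt : B.card < n ^ 2 + n + 1) :
    ∃ T : Finset V, T.card = n + 1 ∧ ∀ M ∈ B, (M ∩ T).card = 1 := by
  by_cases hone : ∃ p, deficiency n B p = 1
  · obtain ⟨p, hp⟩ := hone
    obtain ⟨T, -, h⟩ := hB.exists_transversal_of_deficiency_eq_one hV hp
    exact ⟨T, h⟩
  push Not at hone
  obtain ⟨E, hE⟩ : ∃ E : ℤ, (B.card : ℤ) = n ^ 2 - E := ⟨n ^ 2 - B.card, by ring⟩
  have hN : 0 < (n : ℤ) + 1 + E := by zify at hlt; linarith
  have hEe : E ≤ e := by zify at hcard; linarith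
  have hterm : ∀ p, 0 ≤ deficiency n B p * (deficiency n B p - 2) := by
    intro p
    rcases (hB.deficiency_nonneg hV hn p).eq_or_lt with h | h
    · rw [← h, zero_mul]
    · exact mul_nonneg h.le (by have := hone p; omega)
  have h1 := hB.sum_deficiency_mul_sub_two hV hE
  have hE1 : 1 ≤ E := by
    have h2 : 0 ≤ ∑ p, deficiency n B p * (deficiency n B p - 2) :=
      Finset.sum_nonneg fun p _ => hterm p
    rw [h1] at h2
    linarith [nonneg_of_mul_nonneg_right h2 hN]
  rcases he with rfl | ⟨hl, hl'⟩ | ⟨rfl, rfl⟩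
  · push_cast at hEe
    omega
  · obtain ⟨p, hp⟩ : ∃ p, deficiency n B p = 2 := by
      by_contra hno
      push Not at hno
      -- Without deficiencies `1` and `2`, `d ≤ d (d - 2)` at every point; summing would give `n + 1
      -- ≤ E - 1`.
      have h2 : ∑ p, deficiency n B p ≤ ∑ p, deficiency n B p * (deficiency n B p - 2) := by
        refine Finset.sum_le_sum fun p _ => ?_
        rcases (hB.deficiency_nonneg hV hn p).eq_or_lt with h | h
        · rw [← h, zero_mul]
        · have h3 : 3 ≤ deficiency n B p := by
            have := hone p
            have := hno p
            omega
          nlinarith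
      rw [h1, hB.sum_deficiency hV hE, mul_comm] at h2
      have h3 := le_of_mul_le_mul_left h2 hN
      zify at hl
      linarith
    refine IsDoublePoint.exists_transversal (E := E) (p := p)
      ⟨hB, hV, hE, hp, hone, hE1, ?_, ?_⟩
    · zify at hl
      linarith
    · zify at hl'
      nlinarith
  -- Here all deficiencies are `0` or `2`, yet on a line they sum to `n + 1 + E = 5`.
  · have hE' : E = 1 := le_antisymm (by exact_mod_cast hEe) hE1
    rw [hE', sub_self, mul_zero, Finset.sum_eq_zero_iff_of_nonneg fun p _ => hterm p] at h1
    obtain ⟨L, hL⟩ : B.Nonempty := by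
      rw [← Finset.card_pos]
      rw [hE'] at hE
      norm_num at hE
      omega
    have h2 := hB.sum_deficiency_line hE hL
    have h3 : (2 : ℤ) ∣ ∑ p ∈ L, deficiency 3 B p := by
      refine Finset.dvd_sum fun p _ => ?_
      rcases mul_eq_zero.1 (h1 p (Finset.mem_univ p)) with h | h
      · rw [h]; exact dvd_zero _
      · exact ⟨1, by linarith⟩
    rw [h2, hE'] at h3
    norm_num at h3

/-- A dual linear space of order `n` with almost `n ^ 2` lines on `n ^ 2 + n + 1` points can be
completed to a projective plane. -/
theorem exists_completion (hB : IsDualLinearSpace n B) (hV : Fintype.card V = n ^ 2 + n + 1)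
    (hn : 1 ≤ n) {e : ℕ} (he : IsSmallDefect n e) (hcard : n ^ 2 ≤ B.card + e) :
    ∃ B', B ⊆ B' ∧ IsDualLinearSpace n B' ∧ B'.card = n ^ 2 + n + 1 := by
  induction h : n ^ 2 + n + 1 - B.card generalizing B with
  | zero =>
    have := hB.card_lines_le hV hn
    exact ⟨B, subset_rfl, hB, by omega⟩
  | succ k ih =>
    obtain ⟨T, hT, hT'⟩ := hB.exists_transversal hV hn he hcard (by omega)
    obtain ⟨h1, h2⟩ := hB.insert_transversal hn hT hT'
    obtain ⟨B', h3, h4⟩ := ih h1 (by omega) (by omega)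
    exact ⟨B', (Finset.subset_insert _ _).trans h3, h4⟩

end IsDualLinearSpace

/-! ### Projective planes, affine planes and points at infinity. -/

namespace IsDualLinearSpace

variable {V : Type*} [DecidableEq V] [Fintype V] {n : ℕ} {B : Finset (Finset V)}

/-- In a projective plane any two points are joined. -/
theorem exists_line (hB : IsDualLinearSpace n B) (hV : Fintype.card V = n ^ 2 + n + 1)
    (hn : 1 ≤ n) (hcard : B.card = n ^ 2 + n + 1) {p q : V} (hpq : p ≠ q) :
    ∃ L ∈ B, p ∈ L ∧ q ∈ L := by
  -- A full set of lines corresponds to `E = -(n + 1)`, for which the deficiencies sum to zero.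
  have h1 := hB.sum_deficiency hV (E := -(n + 1)) (by rw [hcard]; push_cast; ring)
  rw [add_neg_cancel, mul_zero,
    Finset.sum_eq_zero_iff_of_nonneg fun p _ => hB.deficiency_nonneg hV hn p] at h1
  have h2 := hB.card_unjoined_eq hV p
  rw [h1 p (Finset.mem_univ p), mul_zero] at h2
  have h3 : q ∉ unjoined B p := by
    rw [Finset.card_eq_zero.1 (show (unjoined B p).card = 0 by exact_mod_cast h2)]
    exact Finset.notMem_empty q
  rw [mem_unjoined] at h3
  push Not at h3
  exact h3 hpq.symm

theorem isProjectivePlane (hB : IsDualLinearSpace n B) (hV : Fintype.card V = n ^ 2 + n + 1)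
    (hn : 2 ≤ n) (hcard : B.card = n ^ 2 + n + 1) : IsProjectivePlane n B :=
  ⟨hn, hV, hB.card_line, fun L hL M hM h => (hB.meet L hL M hM h).le, hcard⟩

end IsDualLinearSpace

theorem exists_mem_inr_unique {P C : Type*} [DecidableEq P] [DecidableEq C] [Fintype C] {n : ℕ}
    {B : Finset (Finset (P ⊕ C))} (hB : IsDualLinearSpace n B)
    (hinf : Finset.disjSum ∅ Finset.univ ∈ B) {L : Finset (P ⊕ C)} (hL : L ∈ B)
    (hne : L ≠ Finset.disjSum ∅ Finset.univ) :
    L.toLeft.card = n ∧ ∃ x : C, ∀ y : C, Sum.inr y ∈ L ↔ y = x := by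
  have h1 := hB.meet L hL _ hinf hne
  have h2 : L ∩ Finset.disjSum ∅ Finset.univ = Finset.disjSum ∅ L.toRight := by
    ext (x | x) <;> simp
  rw [h2, Finset.card_disjSum, Finset.card_empty, zero_add] at h1
  have h3 := Finset.card_toLeft_add_card_toRight (u := L)
  rw [hB.card_line L hL] at h3
  refine ⟨by omega, ?_⟩
  obtain ⟨x, hx⟩ := Finset.card_eq_one.1 h1
  refine ⟨x, fun y => ?_⟩
  rw [← Finset.mem_toRight, hx, Finset.mem_singleton]

/-- Removing a line from a projective plane leaves an affine plane. -/
theorem isAffinePlane_of_projective {P C : Type*} [Fintype P] [DecidableEq P] [DecidableEq C]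
    [Fintype C] {n : ℕ} {B : Finset (Finset (P ⊕ C))} (hB : IsDualLinearSpace n B) (hn : 2 ≤ n)
    (hP : Fintype.card P = n ^ 2) (hC : Fintype.card C = n + 1)
    (hcard : B.card = n ^ 2 + n + 1) (hinf : Finset.disjSum ∅ Finset.univ ∈ B) :
    IsAffinePlane n ((B.erase (Finset.disjSum ∅ Finset.univ)).image Finset.toLeft) := by
  have hV : Fintype.card (P ⊕ C) = n ^ 2 + n + 1 := by
    rw [Fintype.card_sum, hP, hC, add_assoc]
  have hjoin : ∀ p q : P ⊕ C, p ≠ q → ∃ L ∈ B, p ∈ L ∧ q ∈ L :=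
    fun p q hpq => hB.exists_line hV (by omega) hcard hpq
  have hinl : ∀ (p : P) {L : Finset (P ⊕ C)}, Sum.inl p ∈ L →
      L ≠ Finset.disjSum ∅ Finset.univ := by
    rintro p L hp rfl
    simp at hp
  have hmem : ∀ M : Finset P,
      M ∈ (B.erase (Finset.disjSum ∅ Finset.univ)).image Finset.toLeft ↔
        ∃ L ∈ B, L ≠ Finset.disjSum ∅ Finset.univ ∧ L.toLeft = M := by
    intro M
    simp only [Finset.mem_image, Finset.mem_erase]
    exact ⟨fun ⟨L, h, h'⟩ => ⟨L, h.2, h.1, h'⟩, fun ⟨L, h, h', h''⟩ => ⟨L, ⟨h', h⟩, h''⟩⟩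
  have hjoin' : ∀ p q : P, p ≠ q → ∃! L,
      L ∈ (B.erase (Finset.disjSum ∅ Finset.univ)).image Finset.toLeft ∧ p ∈ L ∧ q ∈ L := by
    intro p q hpq
    obtain ⟨L, hL, hp, hq⟩ := hjoin (Sum.inl p) (Sum.inl q) (by simpa using hpq)
    refine ⟨L.toLeft, ⟨(hmem _).2 ⟨L, hL, hinl p hp, rfl⟩, by simpa, by simpa⟩, ?_⟩
    rintro M ⟨hM, hpM, hqM⟩
    obtain ⟨L', hL', -, rfl⟩ := (hmem _).1 hM
    rw [Finset.mem_toLeft] at hpM hqM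
    rw [hB.line_eq hL hL' (by simpa using hpq : (Sum.inl p : P ⊕ C) ≠ Sum.inl q) hp hq hpM hqM]
  refine ⟨hP, ?_, hjoin', ?_, ?_⟩
  · intro M hM
    obtain ⟨L, hL, hne, rfl⟩ := (hmem _).1 hM
    exact (exists_mem_inr_unique hB hinf hL hne).1
  · intro M hM p hp
    obtain ⟨L, hL, hne, rfl⟩ := (hmem _).1 hM
    rw [Finset.mem_toLeft] at hp
    obtain ⟨-, x, hx⟩ := exists_mem_inr_unique hB hinf hL hne
    have hxL := (hx x).2 rfl
    obtain ⟨N, hN, hpN, hxN⟩ := hjoin (Sum.inl p) (Sum.inr x) (by simp)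
    have hNL : N ≠ L := by
      rintro rfl
      exact hp hpN
    refine ⟨N.toLeft, ⟨(hmem _).2 ⟨N, hN, hinl p hpN, rfl⟩, by simpa, ?_⟩, ?_⟩
    · rw [Finset.disjoint_left]
      intro q hq hq'
      rw [Finset.mem_toLeft] at hq hq'
      exact hNL (hB.line_eq hN hL (by simp : (Sum.inl q : P ⊕ C) ≠ Sum.inr x) hq hxN hq' hxL)
    · rintro M ⟨hM, hpM, hdisj⟩
      obtain ⟨N', hN', -, rfl⟩ := (hmem _).1 hM
      rw [Finset.mem_toLeft] at hpM
      have hN'L : N' ≠ L := by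
        rintro rfl
        exact hp hpM
      obtain ⟨y, hy⟩ := Finset.card_pos.1 (by rw [hB.meet N' hN' L hL hN'L]; exact one_pos)
      rw [Finset.mem_inter] at hy
      rcases y with y | y
      · exact absurd (Finset.mem_toLeft.2 hy.2)
          (Finset.disjoint_left.1 hdisj (Finset.mem_toLeft.2 hy.1))
      · rw [(hx y).1 hy.2] at hy
        rw [hB.line_eq hN' hN (by simp : (Sum.inl p : P ⊕ C) ≠ Sum.inr x) hpM hy.1 hpN hxN]
  · have hlt : n < n ^ 2 := by nlinarith
    obtain ⟨p, q, hpq⟩ := Fintype.one_lt_card_iff.1 (show 1 < Fintype.card P by omega)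
    obtain ⟨M, ⟨hM, hpM, hqM⟩, huniq⟩ := hjoin' p q hpq
    have hMc : M.card = n := by
      obtain ⟨L, hL, hne, rfl⟩ := (hmem _).1 hM
      exact (exists_mem_inr_unique hB hinf hL hne).1
    obtain ⟨r, hr⟩ : ∃ r, r ∉ M := by
      by_contra h
      push Not at h
      have := Finset.card_univ (α := P)
      rw [← Finset.eq_univ_iff_forall.2 h] at this
      omega
    refine ⟨p, q, r, hpq, fun h => hr (h ▸ hpM), fun h => hr (h ▸ hqM), ?_⟩
    rintro ⟨N, hN, hpN, hqN, hrN⟩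
    exact hr (huniq N ⟨hN, hpN, hqN⟩ ▸ hrN)

/-- The lines `L ∪ {c L}` for `L` in `A`, where `c L` is a new point on the lines that are parallel
to `L`. -/
def pointsAtInfinity {P C : Type*} [DecidableEq P] [DecidableEq C] (A : Finset (Finset P))
    (c : Finset P → C) : Finset (Finset (P ⊕ C)) :=
  A.image (fun L => L.disjSum {c L})

theorem card_disjSum_inter_disjSum {P C : Type*} [DecidableEq P] [DecidableEq C] (L M : Finset P) (c d : C) :
    (L.disjSum {c} ∩ M.disjSum {d}).card = (L ∩ M).card + if c = d then 1 else 0 := by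
  have h : L.disjSum {c} ∩ M.disjSum {d} = (L ∩ M).disjSum ({c} ∩ {d}) := by
    ext (x | x) <;> simp
  rw [h, Finset.card_disjSum]
  split_ifs with hcd
  · rw [hcd, Finset.inter_self, Finset.card_singleton]
  · rw [Finset.singleton_inter_of_notMem (by simpa using hcd), Finset.card_empty]

theorem disjSum_injective {P C : Type*} (c : Finset P → C) :
    Function.Injective (fun L : Finset P => L.disjSum {c L}) := by
  intro L M h
  have := congrArg Finset.toLeft h
  simpa using this

theorem card_pointsAtInfinity {P C : Type*} [DecidableEq P] [DecidableEq C]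
    {A : Finset (Finset P)} (c : Finset P → C) :
    (pointsAtInfinity A c).card = A.card :=
  Finset.card_image_of_injective _ (disjSum_injective c)

namespace IsPartialAffinePlane

variable {P C : Type*} [Fintype P] [DecidableEq P] [DecidableEq C] {n : ℕ}
  {A : Finset (Finset P)}

/-- Distinct parallel lines meet just at infinity, nonparallel lines just in the affine part. -/
theorem isDualLinearSpace (hA : IsPartialAffinePlane n A) {c : Finset P → C}
    (hc : ∀ L ∈ A, ∀ M ∈ A, c L = c M ↔ IsParallel L M) :
    IsDualLinearSpace n (pointsAtInfinity A c) := by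
  constructor
  · intro L' hL'
    obtain ⟨L, hL, rfl⟩ := Finset.mem_image.1 hL'
    rw [Finset.card_disjSum, hA.card_line L hL, Finset.card_singleton]
  · intro L' hL' M' hM' hne
    obtain ⟨L, hL, rfl⟩ := Finset.mem_image.1 hL'
    obtain ⟨M, hM, rfl⟩ := Finset.mem_image.1 hM'
    have hLM : L ≠ M := by
      rintro rfl
      exact hne rfl
    rw [card_disjSum_inter_disjSum]
    split_ifs with h
    · rw [hc L hL M hM] at h
      rw [Finset.disjoint_iff_inter_eq_empty.1 (h.resolve_left hLM), Finset.card_empty]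
    · rw [hc L hL M hM, IsParallel, not_or, Finset.disjoint_iff_inter_eq_empty,
        ← Finset.card_eq_zero] at h
      have := hA.meet L hL M hM hLM
      omega

/-- The `n + 1` colours form a line at infinity meeting every extended line once. It accounts for
the `+ 1` in `hcard`, and removing it after completion leaves an affine plane containing `A`. -/
theorem isCompletable_of_coloring (hA : IsPartialAffinePlane n A) {c : Finset P → Fin (n + 1)}
    (hc : ∀ L ∈ A, ∀ M ∈ A, c L = c M ↔ IsParallel L M) {e : ℕ} (he : IsSmallDefect n e)
    (hcard : n ^ 2 ≤ A.card + 1 + e) : IsCompletable n A := by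
  have hn := hA.two_le
  have hB := hA.isDualLinearSpace hc
  obtain ⟨h1, h2⟩ := hB.insert_transversal (T := Finset.disjSum ∅ Finset.univ) (by omega)
    (by simp) (by
      intro M' hM'
      obtain ⟨M, hM, rfl⟩ := Finset.mem_image.1 hM'
      have : M.disjSum {c M} ∩ Finset.disjSum ∅ Finset.univ = Finset.disjSum ∅ {c M} := by
        ext (x | x) <;> simp
      rw [this]
      simp)
  rw [card_pointsAtInfinity] at h2
  have hV : Fintype.card (P ⊕ Fin (n + 1)) = n ^ 2 + n + 1 := by
    rw [Fintype.card_sum, hA.card_points, Fintype.card_fin, add_assoc]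
  obtain ⟨B', hsub, hB', hcard'⟩ := h1.exists_completion hV (by omega) he (by omega)
  refine ⟨_, ?_, isAffinePlane_of_projective hB' hn hA.card_points (Fintype.card_fin _) hcard'
    (hsub (Finset.mem_insert_self _ _))⟩
  intro L hL
  refine Finset.mem_image.2 ⟨L.disjSum {c L}, Finset.mem_erase.2 ⟨?_, hsub
    (Finset.mem_insert_of_mem (Finset.mem_image_of_mem _ hL))⟩, by simp⟩
  intro h
  have h3 := congrArg Finset.toLeft h
  simp only [Finset.toLeft_disjSum] at h3
  have h4 := hA.card_line L hL
  rw [h3, Finset.card_empty] at h4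
  omega

end IsPartialAffinePlane

/-! ### Parallel classes, and the case of at most `n + 1` of them. -/

open Classical in
/-- The lines of `A` that are parallel to `L`. -/
noncomputable def parallelClass {P : Type*} (A : Finset (Finset P)) (L : Finset P) :
    Finset (Finset P) :=
  A.filter (fun M => IsParallel L M)

theorem mem_parallelClass {P : Type*} {A : Finset (Finset P)} {L M : Finset P} :
    M ∈ parallelClass A L ↔ M ∈ A ∧ IsParallel L M := by
  classical
  rw [parallelClass, Finset.mem_filter]

theorem parallelClass_eq_iff {P : Type*} {A : Finset (Finset P)}
    (hpar : ParallelismIsEquivalence A) {L M : Finset P} (hL : L ∈ A) (hM : M ∈ A) :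
    parallelClass A L = parallelClass A M ↔ IsParallel L M := by
  constructor
  · intro h
    have h1 : M ∈ parallelClass A M := mem_parallelClass.2 ⟨hM, Or.inl rfl⟩
    rw [← h] at h1
    exact (mem_parallelClass.1 h1).2
  · intro h
    ext N
    rw [mem_parallelClass, mem_parallelClass]
    refine and_congr_right fun hN => ⟨fun h1 => ?_, fun h1 => ?_⟩
    · exact hpar.trans (x := ⟨M, hM⟩) (y := ⟨L, hL⟩) (z := ⟨N, hN⟩)
        (hpar.symm (x := ⟨L, hL⟩) (y := ⟨M, hM⟩) h) h1
    · exact hpar.trans (x := ⟨L, hL⟩) (y := ⟨M, hM⟩) (z := ⟨N, hN⟩) h h1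

theorem IsPartialAffinePlane.isCompletable {P : Type*} [Fintype P] [DecidableEq P] {n : ℕ}
    {A : Finset (Finset P)} (hA : IsPartialAffinePlane n A) (hpar : ParallelismIsEquivalence A)
    (hm : (A.image (parallelClass A)).card ≤ n + 1) {e : ℕ} (he : IsSmallDefect n e)
    (hcard : n ^ 2 ≤ A.card + 1 + e) : IsCompletable n A := by
  obtain ⟨j⟩ : Nonempty ({x // x ∈ A.image (parallelClass A)} ↪ Fin (n + 1)) := by
    refine Function.Embedding.nonempty_of_card_le ?_
    rwa [Fintype.card_coe, Fintype.card_fin]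
  classical
  refine hA.isCompletable_of_coloring
    -- The value `0` off `A` is never used: colours are compared on lines of `A` only.
    (c := fun L => if h : L ∈ A then j ⟨parallelClass A L, Finset.mem_image_of_mem _ h⟩ else 0)
    ?_ he hcard
  intro L hL M hM
  rw [dif_pos hL, dif_pos hM, j.injective.eq_iff, Subtype.mk.injEq, parallelClass_eq_iff hpar hL hM]

/-! ### Counting when a line is missing at every point. -/

/-- The points that are on some line. -/
def coveredPoints {V : Type*} [Fintype V] [DecidableEq V] (B : Finset (Finset V)) : Finset V :=
  Finset.univ.filter (fun p => 0 < valency B p)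

theorem mem_coveredPoints {V : Type*} [Fintype V] [DecidableEq V] {B : Finset (Finset V)} {p : V} :
    p ∈ coveredPoints B ↔ 0 < valency B p := by
  simp [coveredPoints]

theorem mem_coveredPoints_of_mem {V : Type*} [Fintype V] [DecidableEq V] {B : Finset (Finset V)}
    {p : V} {L : Finset V} (hL : L ∈ B) (hp : p ∈ L) : p ∈ coveredPoints B :=
  mem_coveredPoints.2 (valency_pos_iff.2 ⟨L, hL, hp⟩)

namespace IsDualLinearSpace

variable {V : Type*} [DecidableEq V] {n : ℕ} {B : Finset (Finset V)} {E : ℤ}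

theorem sum_deficiency_sub_one_line (hB : IsDualLinearSpace n B) (hE : (B.card : ℤ) = n ^ 2 - E)
    {L : Finset V} (hL : L ∈ B) : ∑ p ∈ L, (deficiency n B p - 1) = E := by
  rw [Finset.sum_sub_distrib, hB.sum_deficiency_line hE hL, Finset.sum_const, hB.card_line L hL,
    nsmul_eq_mul]
  push_cast
  ring

variable [Fintype V]

theorem deficiency_sub_one_le (hB : IsDualLinearSpace n B) (hE : (B.card : ℤ) = n ^ 2 - E)
    (hle : ∀ p, 1 ≤ deficiency n B p) {p : V} (hp : p ∈ coveredPoints B) :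
    deficiency n B p - 1 ≤ E := by
  obtain ⟨L, hL, hpL⟩ := valency_pos_iff.1 (mem_coveredPoints.1 hp)
  rw [← hB.sum_deficiency_sub_one_line hE hL]
  exact Finset.single_le_sum (f := fun p => deficiency n B p - 1)
    (fun q _ => by linarith [hle q]) hpL

theorem sum_coveredPoints (f : ℕ → ℤ) (hf : f 0 = 0) :
    ∑ p ∈ coveredPoints B, f (valency B p) = ∑ p, f (valency B p) := by
  refine Finset.sum_subset (Finset.subset_univ _) fun p _ hp => ?_
  rw [mem_coveredPoints, not_lt, Nat.le_zero] at hp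
  rw [hp, hf]

theorem sum_deficiency_sub_one (hB : IsDualLinearSpace n B) (hE : (B.card : ℤ) = n ^ 2 - E) :
    ∑ p ∈ coveredPoints B, (deficiency n B p - 1)
      = n * (coveredPoints B).card - (n + 1) * (n ^ 2 - E) := by
  have h1 := sum_coveredPoints (B := B) (fun k => (k : ℤ)) rfl
  have h2 := hB.sum_valency_univ
  zify at h2
  rw [h2, hE] at h1
  have h3 : ∀ p, deficiency n B p - 1 = n - valency B p := fun p => by unfold deficiency; ring
  simp_rw [h3]
  rw [Finset.sum_sub_distrib, h1, Finset.sum_const, nsmul_eq_mul]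
  ring

theorem sum_deficiency_sub_one_sq (hB : IsDualLinearSpace n B) (hE : (B.card : ℤ) = n ^ 2 - E) :
    ∑ p ∈ coveredPoints B, (deficiency n B p - 1) ^ 2
      = n ^ 2 * (coveredPoints B).card - 2 * n * (n + 1) * (n ^ 2 - E)
        + (n ^ 2 - E) * (n ^ 2 - E + n) := by
  have h1 := sum_coveredPoints (B := B) (fun k => (k : ℤ) ^ 2 - 2 * n * k) (by norm_num)
  have h2 := hB.sum_valency_univ
  zify at h2
  rw [Finset.sum_sub_distrib, Finset.sum_sub_distrib, ← Finset.mul_sum, ← Finset.mul_sum, h2,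
    hB.sum_valency_sq, hE] at h1
  have h3 : ∀ p, (deficiency n B p - 1) ^ 2
      = n ^ 2 + ((valency B p : ℤ) ^ 2 - 2 * n * valency B p) :=
    fun p => by unfold deficiency; ring
  simp_rw [h3]
  rw [Finset.sum_add_distrib, Finset.sum_sub_distrib, ← Finset.mul_sum, h1, Finset.sum_const,
    nsmul_eq_mul]
  ring

/-- Every summand is nonnegative when all deficiencies are at least `1`, so the right side restricts
`w`, the possibly negative shortfall of covered points from `n ^ 2 + n + 1`. -/
theorem sum_deficiency_mul (hB : IsDualLinearSpace n B) (hE : (B.card : ℤ) = n ^ 2 - E)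
    {w : ℤ} (hw : ((coveredPoints B).card : ℤ) = n ^ 2 + n + 1 - w) :
    ∑ p ∈ coveredPoints B, (deficiency n B p - 1) * (E - (deficiency n B p - 1))
      = n * (E * (E - w) - n * (1 - w)) := by
  have h3 : ∀ p, (deficiency n B p - 1) * (E - (deficiency n B p - 1))
      = E * (deficiency n B p - 1) - (deficiency n B p - 1) ^ 2 := fun p => by ring
  simp_rw [h3]
  rw [Finset.sum_sub_distrib, ← Finset.mul_sum, hB.sum_deficiency_sub_one hE,
    hB.sum_deficiency_sub_one_sq hE, hw]
  ring

theorem deficiency_mul_nonneg (hB : IsDualLinearSpace n B) (hE : (B.card : ℤ) = n ^ 2 - E)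
    (hle : ∀ p, 1 ≤ deficiency n B p) {p : V} (hp : p ∈ coveredPoints B) :
    0 ≤ (deficiency n B p - 1) * (E - (deficiency n B p - 1)) :=
  mul_nonneg (by linarith [hle p]) (by linarith [hB.deficiency_sub_one_le hE hle hp])

/-- If there are missing lines at every point, then many lines are missing. -/
theorem order_mul_le (hB : IsDualLinearSpace n B) (hn : 1 ≤ n) (hE : (B.card : ℤ) = n ^ 2 - E)
    (hle : ∀ p, 1 ≤ deficiency n B p) {w : ℤ}
    (hw : ((coveredPoints B).card : ℤ) = n ^ 2 + n + 1 - w) :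
    n * (1 - w) ≤ E * (E - w) := by
  have h1 := hB.sum_deficiency_mul hE hw
  have h2 := Finset.sum_nonneg fun p hp => hB.deficiency_mul_nonneg hE hle (p := p) hp
  rw [h1] at h2
  have h3 := nonneg_of_mul_nonneg_right h2 (by exact_mod_cast hn)
  linarith

/-- If lines are missing at every point, but not too many, then the missing lines can be found by
adding one after the other. -/
theorem exists_completion_of_covered (hB : IsDualLinearSpace n B) (hn : 2 ≤ n) {e : ℕ}
    (hcard : B.card + e = n ^ 2) (hV : Fintype.card V = n ^ 2 + n + 1)
    (hpos : ∀ p, 0 < valency B p) (hle : ∀ p, 1 ≤ deficiency n B p) (he : e * (e + 1) ≤ 2 * n) :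
    ∃ B', B ⊆ B' ∧ IsDualLinearSpace n B' ∧ B'.card = n ^ 2 + n + 1 := by
  have hE : (B.card : ℤ) = n ^ 2 - e := by zify at hcard; linarith
  have hcov : coveredPoints B = Finset.univ :=
    Finset.eq_univ_iff_forall.2 fun p => mem_coveredPoints.2 (hpos p)
  set U := Finset.univ.filter (fun p => deficiency n B p = 1)
  -- With `x = d - 1`, any `1 ≤ x ≤ e` satisfies `(e + 1) x - x ^ 2 ≥ e`, because `(x - 1) (e - x) ≥
  -- 0`. Summation bounds the number of points with `x ≠ 0`.
  have hU : ∀ t < e, (n + 1) * t < U.card := by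
    intro t ht
    have h1 := hB.sum_deficiency_sub_one hE
    have h2 := hB.sum_deficiency_sub_one_sq hE
    rw [hcov, Finset.card_univ, hV] at h1 h2
    have h3 : ∑ p, (if deficiency n B p = 1 then 0 else (e : ℤ)) ≤
        ∑ p, ((e + 1) * (deficiency n B p - 1) - (deficiency n B p - 1) ^ 2) := by
      refine Finset.sum_le_sum fun p _ => ?_
      have h4 := hB.deficiency_sub_one_le hE hle (p := p) (hcov ▸ Finset.mem_univ p)
      split_ifs with h5
      · rw [h5]; norm_num
      · have h6 : 2 ≤ deficiency n B p := by have := hle p; omega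
        nlinarith [mul_nonneg (by linarith : 0 ≤ deficiency n B p - 2)
          (by linarith : 0 ≤ (e : ℤ) - (deficiency n B p - 1))]
    have h4 : ∑ p, (if deficiency n B p = 1 then 0 else (e : ℤ)) =
        e * (n ^ 2 + n + 1) - e * U.card := by
      have : ∀ p, (if deficiency n B p = 1 then 0 else (e : ℤ)) =
          e - e * (if deficiency n B p = 1 then 1 else 0) := by
        intro p; split_ifs <;> ring
      simp_rw [this]
      rw [Finset.sum_sub_distrib, ← Finset.mul_sum, Finset.sum_boole, Finset.sum_const,
        Finset.card_univ, hV, nsmul_eq_mul]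
      push_cast
      ring
    rw [h4, Finset.sum_sub_distrib, ← Finset.mul_sum, h1, h2] at h3
    push_cast at h3
    have h5 : (e : ℤ) * n ^ 2 - n * e ^ 2 + n ^ 2 - n ≤ e * U.card := by linarith
    have h6 : ((n : ℤ) + 1) * (e - 1) < U.card := by
      have he1 : (1 : ℤ) ≤ e := by omega
      have hn' : (2 : ℤ) ≤ n := by exact_mod_cast hn
      have he' : (e : ℤ) * (e + 1) ≤ 2 * n := by exact_mod_cast he
      refine lt_of_mul_lt_mul_left (a := (e : ℤ)) (lt_of_lt_of_le ?_ h5) (by linarith)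
      rcases he1.eq_or_lt with h | h
      · rw [← h]
        nlinarith
      · rcases (show (2 : ℤ) ≤ e by omega).eq_or_lt with h7 | h7
        · rw [← h7] at he' ⊢
          nlinarith
        · have h8 : (3 : ℤ) ≤ e := by omega
          nlinarith [mul_le_mul_of_nonneg_left he' (by linarith : (0 : ℤ) ≤ 2 * n),
            mul_nonneg (by linarith : (0 : ℤ) ≤ (e : ℤ) - 3) (sq_nonneg (n : ℤ)),
            mul_nonneg (by linarith : (0 : ℤ) ≤ (e : ℤ) - 3) (by linarith : (0 : ℤ) ≤ n)]
    zify
    nlinarith [mul_nonneg (by positivity : (0 : ℤ) ≤ n + 1) (by zify at ht; linarith : (0 : ℤ) ≤ e - 1 - t)]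
  -- `S` collects the points of the added lines. It is smaller than `U`, so some point still has
  -- deficiency `1` and yields the next line.
  have hext : ∀ t ≤ e, ∃ (B' : Finset (Finset V)) (S : Finset V), B ⊆ B' ∧ IsDualLinearSpace n B' ∧ B'.card = B.card + t ∧
      S.card ≤ (n + 1) * t ∧ ∀ p ∉ S, valency B' p = valency B p := by
    intro t
    induction t with
    | zero => exact fun _ => ⟨B, ∅, subset_rfl, hB, by simp, by simp, fun _ _ => rfl⟩
    | succ t ih =>
      intro ht
      obtain ⟨B', S, h1, h2, h3, h4, h5⟩ := ih (by omega)
      obtain ⟨p, hpU, hpS⟩ := Finset.exists_mem_notMem_of_card_lt_card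
        (h4.trans_lt (hU t (by omega)))
      have hp : deficiency n B' p = 1 := by
        rw [← (Finset.mem_filter.1 hpU).2]
        unfold deficiency
        rw [h5 p hpS]
      obtain ⟨T, -, hT, hT'⟩ := h2.exists_transversal_of_deficiency_eq_one hV hp
      obtain ⟨h6, h7⟩ := h2.insert_transversal (by omega) hT hT'
      refine ⟨insert T B', S ∪ T, h1.trans (Finset.subset_insert _ _), h6, by omega, ?_, ?_⟩
      · have := Finset.card_union_le S T
        rw [hT] at this
        linarith
      · intro q hq
        rw [Finset.notMem_union] at hq
        rw [← h5 q hq.1, valency, valency, Finset.filter_insert, if_neg hq.2]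
  obtain ⟨B', -, h1, h2, h3, -⟩ := hext e le_rfl
  -- Once `n ^ 2` lines are present, a point of deficiency `1` exists as long as the plane is
  -- incomplete.
  obtain ⟨B'', h4, h5⟩ := h2.exists_completion hV (by omega) (e := 0) (Or.inl rfl) (by omega)
  exact ⟨B'', h1.trans h4, h5⟩

end IsDualLinearSpace

/-! ### More than `n + 1` parallel classes. -/

theorem valency_pointsAtInfinity_inl {P C : Type*} [DecidableEq P] [DecidableEq C]
    {A : Finset (Finset P)} (c : Finset P → C) (p : P) :
    valency (pointsAtInfinity A c) (Sum.inl p) = valency A p := by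
  rw [valency, valency, pointsAtInfinity, Finset.filter_image,
    Finset.card_image_of_injective _ (disjSum_injective c)]
  simp

theorem valency_pointsAtInfinity_inr {P C : Type*} [DecidableEq P] [DecidableEq C]
    {A : Finset (Finset P)} (c : Finset P → C) (x : C) :
    valency (pointsAtInfinity A c) (Sum.inr x) = (A.filter (fun L => c L = x)).card := by
  rw [valency, pointsAtInfinity, Finset.filter_image,
    Finset.card_image_of_injective _ (disjSum_injective c)]
  simp [eq_comm]

namespace IsPartialAffinePlane

variable {P : Type*} [DecidableEq P] {n : ℕ} {A : Finset (Finset P)}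

/-- The projective extension of a partial affine plane by its parallel classes. -/
noncomputable abbrev extension (A : Finset (Finset P)) : Finset (Finset (P ⊕ Finset (Finset P))) :=
  pointsAtInfinity A (parallelClass A)

theorem valency_inr_pos_iff {x : Finset (Finset P)} :
    0 < valency (extension A) (Sum.inr x) ↔ x ∈ A.image (parallelClass A) := by
  rw [valency_pointsAtInfinity_inr, Finset.card_pos, Finset.mem_image]
  simp [Finset.Nonempty]

variable [Fintype P]

theorem isDualLinearSpace_extension (hA : IsPartialAffinePlane n A)
    (hpar : ParallelismIsEquivalence A) : IsDualLinearSpace n (extension A) :=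
  hA.isDualLinearSpace fun _ hL _ hM => parallelClass_eq_iff hpar hL hM

/-- Every set of sets of points is formally a point at infinity; being covered singles out the
actual parallel classes. -/
theorem coveredPoints_extension :
    coveredPoints (extension A) =
      (Finset.univ.filter (fun p => 0 < valency A p)).disjSum (A.image (parallelClass A)) := by
  ext (p | x)
  · rw [mem_coveredPoints, valency_pointsAtInfinity_inl, Finset.inl_mem_disjSum]
    simp
  · rw [mem_coveredPoints, valency_inr_pos_iff, Finset.inr_mem_disjSum]

theorem card_coveredPoints_extension :
    (coveredPoints (extension A)).card + (Finset.univ.filter (fun p => valency A p = 0)).card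
      = Fintype.card P + (A.image (parallelClass A)).card := by
  have h := Finset.card_filter_add_card_filter_not (s := (Finset.univ : Finset P))
    (fun p => valency A p = 0)
  simp_rw [← Nat.pos_iff_ne_zero] at h
  rw [coveredPoints_extension, Finset.card_disjSum, ← Finset.card_univ, ← h]
  ring

theorem valency_le_add_one (hA : IsPartialAffinePlane n A) (hpar : ParallelismIsEquivalence A)
    (p : P) : valency A p ≤ n + 1 := by
  have hB := hA.isDualLinearSpace_extension hpar
  have h := hB.card_eq_add_sum (q := Sum.inl p) (T := Finset.disjSum (Finset.univ.erase p) ∅)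
    (by simp)
  rw [Finset.card_disjSum, Finset.card_erase_of_mem (Finset.mem_univ p), Finset.card_univ,
    hA.card_points, Finset.card_empty, add_zero, Finset.sum_congr rfl (g := fun _ => n - 1),
    Finset.sum_const, smul_eq_mul] at h
  · change _ = _ + valency (extension A) (Sum.inl p) * (n - 1) at h
    rw [valency_pointsAtInfinity_inl] at h
    have hn := hA.two_le
    obtain ⟨k, rfl⟩ : ∃ k, n = k + 2 := ⟨n - 2, by omega⟩
    have h1 : (k + 2) ^ 2 - 1 = (k + 3) * (k + 1) := by
      have : (k + 2) ^ 2 = (k + 3) * (k + 1) + 1 := by ring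
      omega
    rw [h1, show k + 2 - 1 = k + 1 by omega] at h
    exact Nat.le_of_mul_le_mul_right (by omega : valency A p * (k + 1) ≤ (k + 3) * (k + 1))
      (by omega)
  · intro M' hM'
    rw [Finset.mem_filter] at hM'
    obtain ⟨M, hM, rfl⟩ := Finset.mem_image.1 hM'.1
    have h1 : M.disjSum {parallelClass A M} ∩ Finset.disjSum (Finset.univ.erase p) ∅ =
        Finset.disjSum (M.erase p) ∅ := by
      ext (x | x) <;> simp [and_comm]
    rw [h1, Finset.card_disjSum, Finset.card_empty, add_zero, Finset.card_erase_of_mem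
      (by simpa using hM'.2), hA.card_line M hM]

/-- A point on `n + 1` lines is joined to every point of every line, in particular to all points at
infinity. Its lines then represent every class, so there are only `n + 1` classes. -/
theorem valency_le (hA : IsPartialAffinePlane n A) (hpar : ParallelismIsEquivalence A)
    (hm : n + 2 ≤ (A.image (parallelClass A)).card) (p : P) : valency A p ≤ n := by
  by_contra hlt
  have hp : valency A p = n + 1 := le_antisymm (hA.valency_le_add_one hpar p) (by omega)
  have hB := hA.isDualLinearSpace_extension hpar
  have h := hB.card_eq_add_sum (q := Sum.inl p)
    (T := Finset.disjSum ∅ (A.image (parallelClass A))) (by simp)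
  rw [Finset.sum_congr rfl (g := fun _ => 1), ← Finset.card_eq_sum_ones] at h
  · change _ = _ + valency (extension A) (Sum.inl p) at h
    rw [valency_pointsAtInfinity_inl, hp, Finset.card_disjSum, Finset.card_empty, zero_add] at h
    have h0 : Finset.disjSum ∅ (A.image (parallelClass A)) ∩
        unjoined (extension A) (Sum.inl p) = ∅ := by
      rw [Finset.eq_empty_iff_forall_notMem]
      rintro x hx
      rw [Finset.mem_inter] at hx
      rcases x with x | x
      · simp at hx
      · obtain ⟨L, hL, rfl⟩ := Finset.mem_image.1 (Finset.inr_mem_disjSum.1 hx.1)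
        have hL' : L.disjSum {parallelClass A L} ∈ extension A := Finset.mem_image_of_mem _ hL
        have hxL : Sum.inr (parallelClass A L) ∈ L.disjSum {parallelClass A L} := by simp
        by_cases hpL : Sum.inl p ∈ L.disjSum {parallelClass A L}
        · exact (IsDualLinearSpace.mem_unjoined.1 hx.2).2 _ hL' hpL hxL
        · have h1 := hB.card_line_inter_unjoined hL' hpL
          rw [valency_pointsAtInfinity_inl, hp] at h1
          have h2 := Finset.card_pos.2 ⟨_, Finset.mem_inter.2 ⟨hxL, hx.2⟩⟩
          omega
    rw [h0, Finset.card_empty] at h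
    omega
  · intro M' hM'
    rw [Finset.mem_filter] at hM'
    obtain ⟨M, hM, rfl⟩ := Finset.mem_image.1 hM'.1
    have h1 : M.disjSum {parallelClass A M} ∩ Finset.disjSum ∅ (A.image (parallelClass A)) =
        Finset.disjSum ∅ {parallelClass A M} := by
      ext (x | x)
      · simp
      · simp only [Finset.mem_inter, Finset.inr_mem_disjSum, Finset.mem_singleton,
          and_iff_left_iff_imp]
        rintro rfl
        exact Finset.mem_image_of_mem _ hM
    rw [h1]
    simp

theorem valency_inr_le (hA : IsPartialAffinePlane n A) (hpar : ParallelismIsEquivalence A)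
    (x : Finset (Finset P)) : valency (extension A) (Sum.inr x) ≤ n := by
  have hB := hA.isDualLinearSpace_extension hpar
  have h := hB.card_eq_add_sum (q := Sum.inr x) (T := Finset.disjSum Finset.univ ∅)
    (by simp)
  rw [Finset.sum_congr rfl (g := fun _ => n), Finset.sum_const, smul_eq_mul, Finset.card_disjSum,
    Finset.card_univ, hA.card_points] at h
  · change _ = _ + valency (extension A) (Sum.inr x) * n at h
    have hn := hA.two_le
    rw [Finset.card_empty, add_zero] at h
    nlinarith
  · intro M' hM'
    rw [Finset.mem_filter] at hM'
    obtain ⟨M, hM, rfl⟩ := Finset.mem_image.1 hM'.1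
    have h1 : M.disjSum {parallelClass A M} ∩ Finset.disjSum Finset.univ ∅ =
        Finset.disjSum M ∅ := by
      ext (x | x) <;> simp
    rw [h1, Finset.card_disjSum, Finset.card_empty, add_zero, hA.card_line M hM]

theorem one_le_deficiency (hA : IsPartialAffinePlane n A) (hpar : ParallelismIsEquivalence A)
    (hm : n + 2 ≤ (A.image (parallelClass A)).card) (p : P ⊕ Finset (Finset P)) :
    1 ≤ deficiency n (extension A) p := by
  have h : valency (extension A) p ≤ n := by
    rcases p with p | x
    · rw [valency_pointsAtInfinity_inl]
      exact hA.valency_le hpar hm p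
    · exact hA.valency_inr_le hpar x
  unfold deficiency
  omega

theorem sum_valency_eq (hA : IsPartialAffinePlane n A) : ∑ p, valency A p = n * A.card := by
  rw [sum_valency, Finset.sum_congr rfl (g := fun _ => n), Finset.sum_const, smul_eq_mul, mul_comm]
  intro M hM
  rw [Finset.inter_univ, hA.card_line M hM]

theorem sum_valency_le (hA : IsPartialAffinePlane n A) (hpar : ParallelismIsEquivalence A)
    (hm : n + 2 ≤ (A.image (parallelClass A)).card) :
    A.card + (Finset.univ.filter (fun p => valency A p = 0)).card ≤ n ^ 2 := by
  have h1 : ∑ p, (valency A p + if valency A p = 0 then n else 0) ≤ ∑ _p : P, n := by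
    refine Finset.sum_le_sum fun p _ => ?_
    have := hA.valency_le hpar hm p
    split_ifs <;> omega
  rw [Finset.sum_add_distrib, hA.sum_valency_eq, ← Finset.sum_filter, Finset.sum_const,
    Finset.sum_const, Finset.card_univ, hA.card_points, smul_eq_mul, smul_eq_mul] at h1
  have hn := hA.two_le
  refine le_of_mul_le_mul_right (a := n) ?_ (by omega)
  linarith

/-- Cauchy-Schwarz for `n` minus the class size, over the `m` classes. The second moment of the
class sizes is bounded above by bounding that of the valencies below. -/
theorem sum_class_deficiency (hA : IsPartialAffinePlane n A)
    (hpar : ParallelismIsEquivalence A) (hm : n + 2 ≤ (A.image (parallelClass A)).card) {E : ℤ}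
    (hE : (A.card : ℤ) = n ^ 2 - E) {m z : ℤ} (hm' : ((A.image (parallelClass A)).card : ℤ) = m)
    (hz : ((Finset.univ.filter (fun p => valency A p = 0)).card : ℤ) = z) :
    ((m - n) * n + E) ^ 2 ≤ m * (n * z + E ^ 2 - n ^ 2 * (z - (m - n))) := by
  have hB := hA.isDualLinearSpace_extension hpar
  have hcard : (extension A).card = A.card := card_pointsAtInfinity _
  set I := A.image (parallelClass A)
  set a : Finset (Finset P) → ℤ := fun x => valency (extension A) (Sum.inr x)
  have hz0 : ∀ x ∉ I, a x = 0 := by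
    intro x hx
    have := valency_inr_pos_iff (A := A) (x := x).not.2 hx
    simp only [a]
    omega
  have h1 : ∑ x ∈ I, a x = n ^ 2 - E := by
    have h := hB.sum_valency_univ
    rw [Fintype.sum_sum_type, hcard] at h
    simp_rw [valency_pointsAtInfinity_inl] at h
    rw [hA.sum_valency_eq] at h
    rw [Finset.sum_subset (Finset.subset_univ I) fun x _ hx => hz0 x hx, ← hE]
    zify at h
    simp only [a]
    linarith
  have h2 : ∑ x ∈ I, a x ^ 2 + ∑ p, (valency A p : ℤ) ^ 2 = (n ^ 2 - E) * (n ^ 2 - E + n) := by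
    have h := hB.sum_valency_sq
    rw [Fintype.sum_sum_type, hcard, hE] at h
    simp_rw [valency_pointsAtInfinity_inl] at h
    rw [Finset.sum_subset (Finset.subset_univ I) fun x _ hx => by rw [hz0 x hx]; norm_num, ← h,
      add_comm]
  have h3 : (2 * n - 1) * (n * (n ^ 2 - E)) - n * (n - 1) * (n ^ 2 - z) ≤
      ∑ p, (valency A p : ℤ) ^ 2 := by
    -- This is `(v - n) (v - (n - 1)) ≥ 0` for integers `v`, with the defect `n (n - 1)` restored at
    -- `v = 0`.
    have h4 : ∑ p, ((2 * n - 1) * (valency A p : ℤ) - n * (n - 1)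
        + (if valency A p = 0 then (n : ℤ) * (n - 1) else 0)) ≤ ∑ p, (valency A p : ℤ) ^ 2 := by
      refine Finset.sum_le_sum fun p _ => ?_
      have h5 := hA.valency_le hpar hm p
      split_ifs with h6
      · rw [h6]; norm_num
      · rcases h5.eq_or_lt with h7 | h7
        · rw [h7]; linarith
        · zify at h7
          nlinarith
    have h5 := hA.sum_valency_eq
    zify at h5
    rw [Finset.sum_add_distrib, Finset.sum_sub_distrib, ← Finset.mul_sum, h5, hE,
      ← Finset.sum_filter, Finset.sum_const, Finset.sum_const, Finset.card_univ, hA.card_points,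
      nsmul_eq_mul, nsmul_eq_mul, hz] at h4
    push_cast at h4
    linarith
  have h4 := sq_sum_le_card_mul_sum_sq (s := I) (f := fun x => (n : ℤ) - a x)
  have h5 : ∑ x ∈ I, ((n : ℤ) - a x) = (m - n) * n + E := by
    rw [Finset.sum_sub_distrib, h1, Finset.sum_const, nsmul_eq_mul, hm']
    ring
  have h6 : ∑ x ∈ I, ((n : ℤ) - a x) ^ 2 = n ^ 2 * m - 2 * n * (n ^ 2 - E) + ∑ x ∈ I, a x ^ 2 := by
    have : ∀ x, ((n : ℤ) - a x) ^ 2 = n ^ 2 - 2 * n * a x + a x ^ 2 := fun x => by ring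
    simp_rw [this]
    rw [Finset.sum_add_distrib, Finset.sum_sub_distrib, ← Finset.mul_sum, h1, Finset.sum_const,
      nsmul_eq_mul, hm']
    ring
  rw [h5, h6, hm'] at h4
  refine h4.trans (mul_le_mul_of_nonneg_left ?_ (by omega))
  linarith

/-- The number of parallel classes of a partial affine plane with many lines. -/
theorem card_classes_eq (hA : IsPartialAffinePlane n A)
    (hpar : ParallelismIsEquivalence A) (hm : n + 2 ≤ (A.image (parallelClass A)).card) {e : ℕ}
    (hcard : A.card + e = n ^ 2) (he : e * (e + 1) ≤ 2 * n) :
    ((A.image (parallelClass A)).card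
        = n + 1 + (Finset.univ.filter (fun p => valency A p = 0)).card ∧ n ≤ e ^ 2) ∨
    ((A.image (parallelClass A)).card
        = n + 2 + (Finset.univ.filter (fun p => valency A p = 0)).card ∧ e * (e + 1) = 2 * n) := by
  have hE : (A.card : ℤ) = n ^ 2 - e := by zify at hcard; linarith
  have h1 := hA.sum_class_deficiency hpar hm hE rfl rfl
  have h2 := hA.sum_valency_le hpar hm
  have h3 := card_coveredPoints_extension (A := A)
  have hB := hA.isDualLinearSpace_extension hpar
  have hn := hA.two_le
  have h4 := hB.order_mul_le (E := e) (by omega) (by rw [card_pointsAtInfinity, hE])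
    (hA.one_le_deficiency hpar hm) (w := n ^ 2 + n + 1 - (coveredPoints (extension A)).card)
    (by ring)
  rw [hA.card_points] at h3
  generalize (coveredPoints (extension A)).card = b at *
  generalize (A.image (parallelClass A)).card = m at *
  generalize (Finset.univ.filter (fun p => valency A p = 0)).card = z at *
  have hze : z ≤ e := by omega
  obtain ⟨y, rfl⟩ : ∃ y, m = n + y := ⟨m - n, by omega⟩
  have hb : (b : ℤ) = n ^ 2 + n + y - z := by zify at h3; linarith
  rw [hb] at h4
  push_cast at h1
  have hy : 2 ≤ y := by omega
  have he0 : (e : ℤ) * (e + 1) ≤ 2 * n := by exact_mod_cast he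
  have hn0 : (2 : ℤ) ≤ n := by exact_mod_cast hn
  have hen : (e : ℤ) ≤ n := by nlinarith
  -- Here `w = 1 + z - y`. For `y = z + 1 + k` the bound `order_mul_le` reads `n (1 + k) ≤ e (e +
  -- k)`, which leaves only `k = 0` and `k = 1`. For `z ≥ y` it is too weak, and
  -- `sum_class_deficiency` takes over.
  rcases lt_trichotomy z y with hzy | rfl | hzy
  · obtain ⟨k, rfl⟩ : ∃ k, y = z + 1 + k := ⟨y - z - 1, by omega⟩
    push_cast at h4
    ring_nf at h4
    rcases k with _ | k
    · left
      refine ⟨by ring, ?_⟩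
      zify
      push_cast at h4
      linarith
    · right
      push_cast at h4
      have he1 : 2 ≤ e := by
        by_contra hlt
        have : e = 0 ∨ e = 1 := by omega
        rcases this with rfl | rfl
        · push_cast at h4
          nlinarith
        · push_cast at h4
          nlinarith
      have hk : k = 0 := by
        by_contra hk
        have hk1 : (1 : ℤ) ≤ k := by omega
        have he2 : (2 : ℤ) ≤ e := by exact_mod_cast he1
        nlinarith [mul_nonneg (by linarith : (0 : ℤ) ≤ k) (by linarith : (0 : ℤ) ≤ (e : ℤ) - 2),
          mul_le_mul_of_nonneg_right he0 (by linarith : (0 : ℤ) ≤ k + 2),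
          mul_nonneg (mul_nonneg (by linarith : (0 : ℤ) ≤ k) (by linarith : (0 : ℤ) ≤ (e : ℤ) - 2))
            (by linarith : (0 : ℤ) ≤ e)]
      subst hk
      refine ⟨by ring, le_antisymm he ?_⟩
      zify
      push_cast at h4
      linarith
  · exfalso
    have hy0 : (2 : ℤ) ≤ z := by exact_mod_cast hy
    have hz0 : (z : ℤ) ≤ e := by exact_mod_cast hze
    ring_nf at h1
    nlinarith [mul_le_mul_of_nonneg_left hz0 (by positivity : (0 : ℤ) ≤ n * z),
      mul_le_mul_of_nonneg_left hen (by positivity : (0 : ℤ) ≤ z * e),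
      mul_le_mul_of_nonneg_left he0 (by positivity : (0 : ℤ) ≤ n),
      mul_nonneg (mul_nonneg (by linarith : (0 : ℤ) ≤ z - 2) (by linarith : (0 : ℤ) ≤ (z : ℤ) + 1))
        (sq_nonneg (n : ℤ)), sq_nonneg (e : ℤ), mul_pos (by linarith : (0 : ℤ) < n) (by linarith : (0 : ℤ) < e)]
  · exfalso
    have hy0 : (3 : ℤ) ≤ e := by omega
    have hz0 : (z : ℤ) ≤ e := by exact_mod_cast hze
    have hzy0 : (1 : ℤ) ≤ z - y := by omega
    have h5 : (0 : ℤ) ≤ n * z + e ^ 2 - n ^ 2 * (z - y) := by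
      have h6 := (sq_nonneg _).trans h1
      have h7 := nonneg_of_mul_nonneg_right h6 (by positivity)
      linarith
    have h6 : 2 * (e : ℤ) ≤ n := by nlinarith
    nlinarith [mul_le_mul_of_nonneg_left hzy0 (sq_nonneg (n : ℤ)),
      mul_le_mul_of_nonneg_left hz0 (by positivity : (0 : ℤ) ≤ n),
      mul_le_mul_of_nonneg_left h6 (by positivity : (0 : ℤ) ≤ n)]

end IsPartialAffinePlane

/-! ### Restriction to the covered points, and the embedding. -/

/-- The traces of the sets in `B` on the points `f i`. -/
def comapLines {V W : Type*} [DecidableEq V] [Fintype W] [DecidableEq W] (f : W ↪ V)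
    (B : Finset (Finset V)) : Finset (Finset W) :=
  B.image (fun L => Finset.univ.filter (fun i => f i ∈ L))

section comapLines

variable {V W : Type*} [DecidableEq V] [Fintype W] {f : W ↪ V}
  {B : Finset (Finset V)}

theorem map_filter_mem {L : Finset V} (hL : ∀ x ∈ L, ∃ i, f i = x) :
    (Finset.univ.filter (fun i => f i ∈ L)).map f = L := by
  ext x
  simp only [Finset.mem_map, Finset.mem_filter, Finset.mem_univ, true_and]
  constructor
  · rintro ⟨i, hi, rfl⟩
    exact hi
  · intro hx
    obtain ⟨i, rfl⟩ := hL x hx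
    exact ⟨i, hx, rfl⟩

theorem comapLines_injOn (hB : ∀ L ∈ B, ∀ x ∈ L, ∃ i, f i = x) :
    Set.InjOn (fun L => Finset.univ.filter (fun i => f i ∈ L)) (B : Set (Finset V)) := by
  intro L hL M hM h
  rw [← map_filter_mem (hB L hL), ← map_filter_mem (hB M hM)]
  exact congrArg (Finset.map f) h

variable [DecidableEq W]

theorem card_comapLines (hB : ∀ L ∈ B, ∀ x ∈ L, ∃ i, f i = x) :
    (comapLines f B).card = B.card :=
  Finset.card_image_of_injOn (comapLines_injOn hB)

theorem valency_comapLines (hB : ∀ L ∈ B, ∀ x ∈ L, ∃ i, f i = x) (i : W) :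
    valency (comapLines f B) i = valency B (f i) := by
  rw [valency, comapLines, Finset.filter_image, Finset.card_image_of_injOn]
  · simp [valency]
  · exact (comapLines_injOn hB).mono fun L hL => Finset.mem_coe.2 (Finset.mem_filter.1 hL).1

theorem isDualLinearSpace_comapLines {n : ℕ} (hB : IsDualLinearSpace n B)
    (hf : ∀ L ∈ B, ∀ x ∈ L, ∃ i, f i = x) : IsDualLinearSpace n (comapLines f B) := by
  constructor
  · intro L' hL'
    obtain ⟨L, hL, rfl⟩ := Finset.mem_image.1 hL'
    rw [← hB.card_line L hL, ← Finset.card_map f, map_filter_mem (hf L hL)]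
  · intro L' hL' M' hM' hne
    obtain ⟨L, hL, rfl⟩ := Finset.mem_image.1 hL'
    obtain ⟨M, hM, rfl⟩ := Finset.mem_image.1 hM'
    rw [← hB.meet L hL M hM (by rintro rfl; exact hne rfl), ← Finset.card_map f, Finset.map_inter,
      map_filter_mem (hf L hL), map_filter_mem (hf M hM)]

end comapLines

theorem IsPartialAffinePlane.embedsInProjectivePlane {P : Type*} [Fintype P] [DecidableEq P]
    {n : ℕ} {A : Finset (Finset P)} (hA : IsPartialAffinePlane n A)
    (hpar : ParallelismIsEquivalence A) (hm : n + 2 ≤ (A.image (parallelClass A)).card) {e : ℕ}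
    (hcard : A.card + e = n ^ 2) (he : e * (e + 1) ≤ 2 * n)
    (hz : (A.image (parallelClass A)).card
        = n + 1 + (Finset.univ.filter (fun p => valency A p = 0)).card) :
    EmbedsInProjectivePlane n A := by
  have hB := hA.isDualLinearSpace_extension hpar
  have hX := card_coveredPoints_extension (A := A)
  rw [hA.card_points, hz] at hX
  have hX' : (coveredPoints (extension A)).card = n ^ 2 + n + 1 := by omega
  let j := (coveredPoints (extension A)).equivFinOfCardEq hX'
  let f : Fin (n ^ 2 + n + 1) ↪ P ⊕ Finset (Finset P) :=
    j.symm.toEmbedding.trans (Function.Embedding.subtype _)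
  have hf : ∀ L ∈ extension A, ∀ x ∈ L, ∃ i, f i = x := fun L hL x hx =>
    ⟨j ⟨x, mem_coveredPoints_of_mem hL hx⟩, by simp [f]⟩
  have hfX : ∀ i, f i ∈ coveredPoints (extension A) := fun i => (j.symm i).2
  obtain ⟨B', hsub, hB', hcard'⟩ := (isDualLinearSpace_comapLines hB hf).exists_completion_of_covered
    hA.two_le (e := e) (by rw [card_comapLines hf, card_pointsAtInfinity, hcard])
    (Fintype.card_fin _)
    (fun i => by
      rw [valency_comapLines hf]
      exact mem_coveredPoints.1 (hfX i))
    (fun i => by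
      have := hA.one_le_deficiency hpar hm (f i)
      unfold deficiency at this ⊢
      rwa [valency_comapLines hf]) he
  -- Points of valency `0` are not covered, so they are sent to points at infinity, of which there
  -- are `n + 1` more than needed.
  obtain ⟨k⟩ : Nonempty ({p // p ∈ Finset.univ.filter (fun p => valency A p = 0)} ↪
      {x // x ∈ A.image (parallelClass A)}) := by
    refine Function.Embedding.nonempty_of_card_le ?_
    rw [Fintype.card_coe, Fintype.card_coe]
    omega
  let φ : P → P ⊕ Finset (Finset P) := fun p =>
    if h : valency A p = 0 then Sum.inr (k ⟨p, by simpa using h⟩).1 else Sum.inl p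
  have hφ : ∀ p, φ p ∈ coveredPoints (extension A) := by
    intro p
    rw [coveredPoints_extension]
    by_cases h : valency A p = 0
    · simp only [φ, dif_pos h, Finset.inr_mem_disjSum]
      exact (k _).2
    · simp only [φ, dif_neg h, Finset.inl_mem_disjSum]
      simpa [Nat.pos_iff_ne_zero] using h
  have hφi : Function.Injective φ := by
    intro p q hpq
    by_cases hp : valency A p = 0 <;> by_cases hq : valency A q = 0 <;>
      simp only [φ, dif_pos, dif_neg, hp, hq, not_false_eq_true, reduceCtorEq, Sum.inl.injEq,
        Sum.inr.injEq] at hpq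
    · have := k.injective (Subtype.ext hpq)
      simpa using this
    · exact hpq
  refine ⟨Fin (n ^ 2 + n + 1), inferInstance, inferInstance, B',
    ⟨fun p => j ⟨φ p, hφ p⟩, fun p q h => hφi (by simpa using h)⟩,
    hB'.isProjectivePlane (Fintype.card_fin _) hA.two_le hcard', ?_⟩
  intro L hL
  refine ⟨Finset.univ.filter (fun i => f i ∈ L.disjSum {parallelClass A L}),
    hsub (Finset.mem_image_of_mem _ (Finset.mem_image_of_mem _ hL)), fun p hp => ?_⟩
  have hφp : φ p = Sum.inl p := dif_neg hp.ne'
  have h1 : (j.symm (j ⟨φ p, hφ p⟩)).1 = Sum.inl p := by rw [Equiv.symm_apply_apply]; exact hφp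
  rw [Finset.mem_filter]
  change _ ∧ (j.symm (j ⟨φ p, hφ p⟩)).1 ∈ _ ↔ _
  rw [h1]
  simp

/-! ### The extremal case: group divisible designs. -/

section GroupDivisible

variable {V : Type*} [DecidableEq V] {n : ℕ} {B : Finset (Finset V)}

theorem IsDualLinearSpace.eq_of_mem_inter (hB : IsDualLinearSpace n B) {L M : Finset V}
    (hL : L ∈ B) (hM : M ∈ B) (hne : L ≠ M) {x y : V} (hxL : x ∈ L) (hxM : x ∈ M) (hyL : y ∈ L)
    (hyM : y ∈ M) : x = y := by
  by_contra h
  exact hne (hB.line_eq hL hM h hxL hyL hxM hyM)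

/-- The indices of the lines through `x`. -/
def pencil {v : ℕ} (l : Fin v ≃ {L // L ∈ B}) (x : V) : Finset (Fin v) :=
  Finset.univ.filter (fun i => x ∈ (l i).1)

theorem mem_pencil {v : ℕ} {l : Fin v ≃ {L // L ∈ B}} {x : V} {i : Fin v} :
    i ∈ pencil l x ↔ x ∈ (l i).1 := by
  simp [pencil]

theorem card_pencil {v : ℕ} (l : Fin v ≃ {L // L ∈ B}) (x : V) :
    (pencil l x).card = valency B x := by
  rw [valency]
  refine Finset.card_bij (fun i _ => (l i).1) ?_ ?_ ?_
  · intro i hi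
    exact Finset.mem_filter.2 ⟨(l i).2, mem_pencil.1 hi⟩
  · intro i _ i' _ h
    exact l.injective (Subtype.ext h)
  · intro L hL
    rw [Finset.mem_filter] at hL
    exact ⟨l.symm ⟨L, hL.1⟩, by rw [mem_pencil]; simpa using hL.2, by simp⟩

variable [Fintype V]

/-- The extremal dual linear spaces with `n ^ 2 + n + 2` points, at which lines are missing at
every point, come from group divisible designs. -/
theorem IsDualLinearSpace.exists_groupDivisibleDesign (hB : IsDualLinearSpace n B) {e : ℕ}
    (he2 : 2 ≤ e) (hcard : B.card + e = n ^ 2) (he : e * (e + 1) = 2 * n)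
    (hle : ∀ p, 1 ≤ deficiency n B p) (hX : (coveredPoints B).card = n ^ 2 + n + 2) :
    ∃ t u : ℕ, t + e = n ∧ u = n + e + 2 ∧
      ∃ (G : Finpartition (Finset.univ : Finset (Fin B.card))) (D : Finset (Finset (Fin B.card))),
        IsGroupDivisibleDesign n t u G D ∧ D.card = B.card := by
  have hE : (B.card : ℤ) = n ^ 2 - e := by zify at hcard; linarith
  have hw : ((coveredPoints B).card : ℤ) = n ^ 2 + n + 1 - (-1) := by rw [hX]; push_cast; ring
  have he' : (e : ℤ) * (e + 1) = 2 * n := by exact_mod_cast he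
  have hen : e + 1 ≤ n := by nlinarith
  have h0 := hB.sum_deficiency_mul hE hw
  -- For `w = -1` and `e (e + 1) = 2 n` the sum of nonnegative terms vanishes, so each `d - 1` is
  -- `0` or `e`.
  rw [show (n : ℤ) * ((e : ℤ) * (e - -1) - n * (1 - -1)) = 0 by
    linear_combination (n : ℤ) * he', Finset.sum_eq_zero_iff_of_nonneg fun p hp =>
    hB.deficiency_mul_nonneg hE hle hp] at h0
  have hcase : ∀ p ∈ coveredPoints B, deficiency n B p - 1 = 0 ∨ deficiency n B p - 1 = e := by
    intro p hp
    rcases mul_eq_zero.1 (h0 p hp) with h | h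
    · exact Or.inl h
    · exact Or.inr (by linarith)
  set Y := (coveredPoints B).filter (fun p => deficiency n B p - 1 = e) with hY
  set Z := (coveredPoints B).filter (fun p => ¬ deficiency n B p - 1 = e) with hZ
  have he0 : (0 : ℤ) < e := by omega
  have hsumY : ∀ S : Finset V, S ⊆ coveredPoints B →
      ∑ p ∈ S, (deficiency n B p - 1) = e * (S.filter (· ∈ Y)).card := by
    intro S hS
    rw [Finset.card_filter, Nat.cast_sum, Finset.mul_sum]
    refine Finset.sum_congr rfl fun p hp => ?_
    by_cases h : p ∈ Y
    · rw [if_pos h, (Finset.mem_filter.1 h).2]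
      push_cast
      ring
    · rw [if_neg h]
      rcases hcase p (hS hp) with h1 | h1
      · rw [h1]
        push_cast
        ring
      · exact absurd (Finset.mem_filter.2 ⟨hS hp, h1⟩) h
  have hYcard : Y.card = n + e + 2 := by
    have h1 := hsumY _ subset_rfl
    have h2 : (coveredPoints B).filter (· ∈ Y) = Y := by
      ext p
      rw [Finset.mem_filter]
      exact ⟨fun h => h.2, fun h => ⟨(Finset.mem_filter.1 h).1, h⟩⟩
    rw [hB.sum_deficiency_sub_one hE, hw, h2] at h1
    have h3 : (e : ℤ) * Y.card = e * (n + e + 2) := by linear_combination -h1 - he'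
    have h4 := mul_left_cancel₀ he0.ne' h3
    exact_mod_cast h4
  have hZcard : Z.card = B.card := by
    have := Finset.card_filter_add_card_filter_not (s := coveredPoints B)
      (fun p => deficiency n B p - 1 = e)
    rw [← hY, ← hZ, hX, hYcard] at this
    omega
  -- On a line the values `d - 1` sum to `e`, so exactly one of them equals `e`.
  have hline : ∀ L ∈ B, ∃ y ∈ Y, y ∈ L ∧ ∀ x ∈ Y, x ∈ L → x = y := by
    intro L hL
    have h1 := hsumY L fun p hp => mem_coveredPoints_of_mem hL hp
    rw [hB.sum_deficiency_sub_one_line hE hL] at h1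
    have h2 : (L.filter (· ∈ Y)).card = 1 := by
      have : ((L.filter (· ∈ Y)).card : ℤ) = 1 :=
        mul_left_cancel₀ he0.ne' (by rw [mul_one]; exact h1.symm)
      exact_mod_cast this
    obtain ⟨y, hy⟩ := Finset.card_eq_one.1 h2
    have hyL := Finset.mem_filter.1 (hy ▸ Finset.mem_singleton_self y : y ∈ L.filter (· ∈ Y))
    refine ⟨y, hyL.2, hyL.1, fun x hx hxL => ?_⟩
    exact Finset.mem_singleton.1 (hy ▸ Finset.mem_filter.2 ⟨hxL, hx⟩)
  let l : Fin B.card ≃ {L // L ∈ B} := B.equivFin.symm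
  have hval : ∀ x ∈ Y, valency B x + e = n := by
    intro x hx
    have := (Finset.mem_filter.1 hx).2
    unfold deficiency at this
    omega
  have hval' : ∀ x ∈ Z, valency B x = n := by
    intro x hx
    have h1 := Finset.mem_filter.1 hx
    have h2 := (hcase x h1.1).resolve_right h1.2
    unfold deficiency at h2
    omega
  have hYinj : Set.InjOn (pencil l) (Y : Set V) := by
    intro x hx y hy h
    have h1 : (pencil l x).Nonempty := by
      rw [← Finset.card_pos, card_pencil]
      have := hval x hx
      omega
    obtain ⟨i, hi⟩ := h1
    have hi' := h ▸ hi
    rw [mem_pencil] at hi hi'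
    obtain ⟨z, -, -, hz⟩ := hline _ (l i).2
    rw [hz x hx hi, hz y hy hi']
  have hZinj : Set.InjOn (pencil l) (Z : Set V) := by
    intro x hx y hy h
    have h1 : 1 < (pencil l x).card := by
      rw [card_pencil, hval' x hx]
      omega
    obtain ⟨i, hi, k, hk, hik⟩ := Finset.one_lt_card.1 h1
    have hi' := h ▸ hi
    have hk' := h ▸ hk
    rw [mem_pencil] at hi hi' hk hk'
    exact hB.eq_of_mem_inter (l i).2 (l k).2
      (fun h => hik (l.injective (Subtype.ext h))) hi hk hi' hk'
  have hparts : ∀ i ∈ (Finset.univ : Finset (Fin B.card)), ∃! g ∈ Y.image (pencil l), i ∈ g := by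
    intro i _
    obtain ⟨y, hy, hyL, huniq⟩ := hline _ (l i).2
    refine ⟨pencil l y, ⟨Finset.mem_image_of_mem _ hy, mem_pencil.2 hyL⟩, ?_⟩
    rintro g ⟨hg, hig⟩
    obtain ⟨x, hx, rfl⟩ := Finset.mem_image.1 hg
    rw [huniq x hx (mem_pencil.1 hig)]
  let G : Finpartition (Finset.univ : Finset (Fin B.card)) :=
    Finpartition.ofExistsUnique (Y.image (pencil l)) (fun g _ => Finset.subset_univ g) hparts (by
      intro h
      obtain ⟨x, hx, h1⟩ := Finset.mem_image.1 h
      have h2 := card_pencil l x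
      rw [h1, Finset.card_empty] at h2
      have := hval x hx
      omega)
  have hG : ∀ g, g ∈ G.parts ↔ ∃ y ∈ Y, pencil l y = g := fun g => Finset.mem_image
  -- Dualise: lines become points, pencils of points in `Y` become groups, pencils of points in `Z`
  -- become blocks. Two lines lie in a common group or a common block according to where they meet.
  refine ⟨n - e, n + e + 2, by omega, rfl, G, Z.image (pencil l), ?_, ?_⟩
  · refine ⟨?_, ?_, ?_, ?_, ?_, ?_⟩
    · rw [Fintype.card_fin]
      zify [(by omega : e ≤ n)]
      rw [hE]
      linear_combination he'
    · intro b hb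
      obtain ⟨x, hx, rfl⟩ := Finset.mem_image.1 hb
      rw [card_pencil, hval' x hx]
    · change (Y.image (pencil l)).card = _
      rw [Finset.card_image_of_injOn hYinj, hYcard]
    · intro g hg
      obtain ⟨y, hy, rfl⟩ := (hG g).1 hg
      have := hval y hy
      rw [card_pencil]
      omega
    · rintro g hg i hi k hk hik ⟨b, hb, hib, hkb⟩
      obtain ⟨y, hy, rfl⟩ := (hG g).1 hg
      obtain ⟨x, hx, rfl⟩ := Finset.mem_image.1 hb
      rw [mem_pencil] at hi hk hib hkb
      have hxy := hB.eq_of_mem_inter (l i).2 (l k).2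
        (fun h => hik (l.injective (Subtype.ext h))) hib hkb hi hk
      exact (Finset.mem_filter.1 hx).2 (hxy ▸ (Finset.mem_filter.1 hy).2)
    · intro g hg h hh hgh i hi k hk
      obtain ⟨y, hy, rfl⟩ := (hG g).1 hg
      obtain ⟨y', hy', rfl⟩ := (hG h).1 hh
      rw [mem_pencil] at hi hk
      have hik : (l i).1 ≠ (l k).1 := by
        intro hik
        obtain ⟨z, -, -, hz⟩ := hline _ (l i).2
        exact hgh (by rw [hz y hy hi, hz y' hy' (hik ▸ hk)])
      obtain ⟨x, hx⟩ := Finset.card_pos.1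
        (by rw [hB.meet _ (l i).2 _ (l k).2 hik]; exact one_pos)
      rw [Finset.mem_inter] at hx
      have hxZ : x ∈ Z := by
        refine Finset.mem_filter.2 ⟨mem_coveredPoints_of_mem (l i).2 hx.1, fun h => hgh ?_⟩
        have hxY : x ∈ Y := Finset.mem_filter.2 ⟨mem_coveredPoints_of_mem (l i).2 hx.1, h⟩
        obtain ⟨z, -, -, hz⟩ := hline _ (l i).2
        obtain ⟨z', -, -, hz'⟩ := hline _ (l k).2
        rw [hz y hy hi, ← hz x hxY hx.1, hz' x hxY hx.2, ← hz' y' hy' hk]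
      refine ⟨pencil l x, ⟨Finset.mem_image_of_mem _ hxZ, mem_pencil.2 hx.1, mem_pencil.2 hx.2⟩, ?_⟩
      rintro b ⟨hb, hib, hkb⟩
      obtain ⟨x', -, rfl⟩ := Finset.mem_image.1 hb
      rw [mem_pencil] at hib hkb
      rw [hB.eq_of_mem_inter (l i).2 (l k).2 hik hib hkb hx.1 hx.2]
  · rw [Finset.card_image_of_injOn hZinj, hZcard]

end GroupDivisible

/-! ### Numerical consequences of the Dow-Metsch bounds. -/

/-- In this range the term in `√n` outweighs the linear one, so `g₄` exceeds `n ^ 2` and cannot be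
the minimum. -/
theorem sq_add_one_le_boundFour {n : ℕ} (hn : n ≤ 49) : (n : ℝ) ^ 2 + 1 ≤ boundFour n := by
  have h5 : Real.sqrt 5 ≤ 5 / 2 := by
    rw [Real.sqrt_le_iff]
    norm_num
  have h5' : 0 < Real.sqrt 5 := Real.sqrt_pos.2 (by norm_num)
  have hs : Real.sqrt n ≤ 7 := by
    rw [Real.sqrt_le_iff]
    have : (n : ℝ) ≤ 49 := by exact_mod_cast hn
    exact ⟨by norm_num, by linarith⟩
  have hs0 := Real.sqrt_nonneg (n : ℝ)
  have hsq : Real.sqrt n * Real.sqrt n = n := Real.mul_self_sqrt (Nat.cast_nonneg n)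
  have h17 : 34 / 5 ≤ 17 / Real.sqrt 5 := by
    rw [le_div_iff₀ h5']
    linarith
  have h1 : (Real.sqrt 5 - 1) / 2 * n ≤ 3 / 4 * n :=
    mul_le_mul_of_nonneg_right (by linarith) (Nat.cast_nonneg n)
  have h2 : 34 / 5 * Real.sqrt n ≤ 17 / Real.sqrt 5 * Real.sqrt n :=
    mul_le_mul_of_nonneg_right h17 hs0
  unfold boundFour
  nlinarith [mul_le_mul_of_nonneg_left hs hs0]

theorem isSmallDefect_of_lt {n e : ℕ} (he : (e + 1) * (e + 2) < 2 * n)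
    (hg : dowMetschBound n < (n : ℝ) ^ 2 - e) : IsSmallDefect n e := by
  rcases Nat.eq_zero_or_pos e with h0 | h0
  · exact Or.inl h0
  refine Or.inr (Or.inl ?_)
  rcases Nat.lt_or_ge 7 e with h8 | h8
  · exact ⟨by nlinarith, by nlinarith⟩
  -- For `e ≤ 7` and `n ≤ 5 e + 1` all four bounds are at least `n ^ 2 - e`, against `hg`. For
  -- larger `e` the quadratic hypothesis alone suffices.
  have hlt : 5 * e + 2 ≤ n := by
    by_contra hn
    have hn' : (n : ℝ) ≤ 5 * e + 1 := by exact_mod_cast (by omega : n ≤ 5 * e + 1)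
    have h0' : (1 : ℝ) ≤ e := by exact_mod_cast h0
    refine absurd hg (not_lt.2 (le_min (le_min ?_ ?_) (le_min ?_ ?_)))
    · unfold boundOne
      linarith
    · have : Real.sqrt ((n : ℝ) + 3) ≤ (e + 6) / 2 := by
        rw [Real.sqrt_le_iff]
        exact ⟨by positivity, by nlinarith [sq_nonneg ((e : ℝ) - 4)]⟩
      unfold boundTwo
      linarith
    · unfold boundThree
      linarith
    · have := sq_add_one_le_boundFour (n := n) (by omega)
      linarith
  exact ⟨hlt, by interval_cases e <;> omega⟩

theorem isSmallDefect_of_eq {n e : ℕ} (he : (e + 1) * (e + 2) = 2 * n)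
    (hg : dowMetschBound n ≤ (n : ℝ) ^ 2 - e) : IsSmallDefect n e := by
  rcases Nat.eq_zero_or_pos e with h0 | h0
  · exact Or.inl h0
  rcases Nat.lt_or_ge 8 e with h9 | h9
  · exact Or.inr (Or.inl ⟨by nlinarith, by nlinarith⟩)
  -- At `e = 1`, `n = 3` the bound `g₁` equals `n ^ 2 - e` and gives no contradiction, hence the
  -- separate clause in `IsSmallDefect`.
  rcases Nat.eq_or_lt_of_le h0 with rfl | h2
  · exact Or.inr (Or.inr ⟨by omega, rfl⟩)
  exfalso
  have he' : ((e : ℝ) + 1) * (e + 2) = 2 * n := by exact_mod_cast he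
  have h2' : (2 : ℝ) ≤ e := by exact_mod_cast h2
  have h9' : (e : ℝ) ≤ 8 := by exact_mod_cast h9
  refine absurd hg (not_le.2 (lt_min (lt_min ?_ ?_) (lt_min ?_ ?_)))
  · unfold boundOne
    linarith
  · have : Real.sqrt ((n : ℝ) + 3) < (e + 6) / 2 := by
      rw [Real.sqrt_lt' (by positivity)]
      nlinarith
    unfold boundTwo
    linarith
  · unfold boundThree
    nlinarith
  · have := sq_add_one_le_boundFour (n := n) (by nlinarith)
    linarith

theorem sq_sub_lt_of_lt {n v : ℕ} {f : ℝ} (hf : 0 < f)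
    (h : (n : ℝ) ^ 2 - f < v) : ((n ^ 2 - v : ℕ) : ℝ) < f := by
  rcases le_total v (n ^ 2) with hv | hv
  · rw [Nat.cast_sub hv]
    push_cast
    linarith
  · rw [Nat.sub_eq_zero_of_le hv]
    simpa using hf

/-! ### Conclusion. -/

namespace IsPartialAffinePlane

variable {P : Type*} [Fintype P] [DecidableEq P] {n : ℕ} {A : Finset (Finset P)}

/-- A partial affine plane with many lines that cannot be completed has more than `n + 1` parallel
classes. -/
theorem add_two_le_card_classes (hA : IsPartialAffinePlane n A)
    (hpar : ParallelismIsEquivalence A) (hnot : ¬ IsCompletable n A)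
    (hg : dowMetschBound n - 1 < A.card)
    (he : (n ^ 2 - A.card) * (n ^ 2 - A.card + 1) < 2 * n) :
    n + 2 ≤ (A.image (parallelClass A)).card := by
  by_contra hm
  -- The line at infinity counts as a line, so the defect to repair is one less than `n ^ 2 -
  -- A.card`.
  refine hnot (hA.isCompletable hpar (by omega) (e := n ^ 2 - A.card - 1) ?_ (by omega))
  rcases Nat.eq_zero_or_pos (n ^ 2 - A.card) with h0 | h0
  · exact Or.inl (by omega)
  · have h1 : ((n ^ 2 - A.card - 1 : ℕ) : ℝ) = n ^ 2 - A.card - 1 := by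
      rw [Nat.cast_sub h0, Nat.cast_sub (by omega)]
      push_cast
      ring
    refine isSmallDefect_of_lt ?_ (by rw [h1]; linarith)
    rwa [show n ^ 2 - A.card - 1 + 1 = n ^ 2 - A.card by omega,
      show n ^ 2 - A.card - 1 + 2 = n ^ 2 - A.card + 1 by omega]

theorem exists_valency_eq_zero
    (h : (A.image (parallelClass A)).card
      = n + 1 + (Finset.univ.filter (fun p => valency A p = 0)).card)
    (hm : n + 2 ≤ (A.image (parallelClass A)).card) : ∃ p : P, valency A p = 0 := by
  obtain ⟨p, hp⟩ := Finset.card_pos.1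
    (by omega : 0 < (Finset.univ.filter (fun p => valency A p = 0)).card)
  exact ⟨p, (Finset.mem_filter.1 hp).2⟩

/-- A larger `A` has `e ^ 2 < n`, which contradicts both alternatives of `card_classes_eq`. -/
theorem card_le_max (hA : IsPartialAffinePlane n A)
    (hpar : ParallelismIsEquivalence A) (hnot : ¬ IsCompletable n A) :
    (A.card : ℝ) ≤ max (dowMetschBound n - 1) ((n : ℝ) ^ 2 - Real.sqrt (n : ℝ)) := by
  by_contra hlt
  rw [not_le, max_lt_iff] at hlt
  have hn := hA.two_le
  have h1 := sq_sub_lt_of_lt (Real.sqrt_pos.2 (by positivity)) hlt.2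
  rw [Real.lt_sqrt (Nat.cast_nonneg _)] at h1
  have h2 : (n ^ 2 - A.card) ^ 2 < n := by exact_mod_cast h1
  have h3 : (n ^ 2 - A.card) * (n ^ 2 - A.card + 1) < 2 * n := by
    have := Nat.le_self_pow two_ne_zero (n ^ 2 - A.card)
    nlinarith
  have hm := hA.add_two_le_card_classes hpar hnot hlt.1 h3
  -- This yields `A.card ≤ n ^ 2`, so the truncated difference is the true defect.
  have hv := hA.sum_valency_le hpar hm
  rcases hA.card_classes_eq hpar hm (e := n ^ 2 - A.card) (by omega) h3.le with h | h
  · omega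
  · omega

theorem embeds_of_lt (hA : IsPartialAffinePlane n A)
    (hpar : ParallelismIsEquivalence A) (hnot : ¬ IsCompletable n A) {f : ℝ} (hf : 0 < f)
    (hfn : f * (f + 1) = 2 * n)
    (hlt : max (dowMetschBound n - 1) ((n : ℝ) ^ 2 - f) < (A.card : ℝ)) :
    (∃ p : P, valency A p = 0) ∧ EmbedsInProjectivePlane n A := by
  rw [max_lt_iff] at hlt
  have h1 := sq_sub_lt_of_lt hf hlt.2
  have h3 : (n ^ 2 - A.card) * (n ^ 2 - A.card + 1) < 2 * n := by
    have : ((n ^ 2 - A.card : ℕ) : ℝ) * ((n ^ 2 - A.card : ℕ) + 1) < 2 * n := by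
      rw [← hfn]
      gcongr
    exact_mod_cast this
  have hm := hA.add_two_le_card_classes hpar hnot hlt.1 h3
  have hv := hA.sum_valency_le hpar hm
  rcases hA.card_classes_eq hpar hm (e := n ^ 2 - A.card) (by omega) h3.le with h | h
  · exact ⟨exists_valency_eq_zero h.1 hm,
      hA.embedsInProjectivePlane hpar hm (e := n ^ 2 - A.card) (by omega) h3.le h.1⟩
  · omega

theorem embeds_or_exists_groupDivisibleDesign (hA : IsPartialAffinePlane n A)
    (hpar : ParallelismIsEquivalence A) (hnot : ¬ IsCompletable n A) {e : ℕ}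
    (he : e * (e + 1) = 2 * n) (hcard : A.card + e = n ^ 2)
    (hg : dowMetschBound n - 1 ≤ A.card) :
    ((∃ p : P, valency A p = 0) ∧ EmbedsInProjectivePlane n A) ∨
      ∃ t u : ℕ, t + e = n ∧ u = n + e + 2 ∧
        ∃ (G : Finpartition (Finset.univ : Finset (Fin A.card)))
          (D : Finset (Finset (Fin A.card))),
          IsGroupDivisibleDesign n t u G D ∧ D.card = A.card := by
  have hn := hA.two_le
  have he2 : 2 ≤ e := by
    by_contra hlt
    interval_cases e <;> omega
  have hm : n + 2 ≤ (A.image (parallelClass A)).card := by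
    by_contra hm
    obtain ⟨k, rfl⟩ : ∃ k, e = k + 1 := ⟨e - 1, by omega⟩
    refine hnot (hA.isCompletable hpar (by omega) (e := k) (isSmallDefect_of_eq he ?_) (by omega))
    have h1 : (A.card : ℝ) + (k + 1) = n ^ 2 := by exact_mod_cast hcard
    linarith
  rcases hA.card_classes_eq hpar hm hcard he.le with h | h
  · exact Or.inl ⟨exists_valency_eq_zero h.1 hm, hA.embedsInProjectivePlane hpar hm hcard he.le h.1⟩
  · right
    have h1 := card_coveredPoints_extension (A := A)
    rw [hA.card_points, h.1] at h1
    have h2 : (extension A).card = A.card := card_pointsAtInfinity _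
    have h3 := (hA.isDualLinearSpace_extension hpar).exists_groupDivisibleDesign he2
      (by rw [h2, hcard]) he (hA.one_le_deficiency hpar hm) (by omega)
    rwa [h2] at h3

end IsPartialAffinePlane

theorem mainTheorem1 {P : Type*} [Fintype P] [DecidableEq P] (n : ℕ) (A : Finset (Finset P))
    (hA : IsPartialAffinePlane n A) (hpar : ParallelismIsEquivalence A)
    (hnot : ¬ IsCompletable n A) :
    (A.card : ℝ) ≤ max (dowMetschBound n - 1) ((n : ℝ) ^ 2 - Real.sqrt (n : ℝ)) ∧
    ∀ f : ℝ, 0 < f → f * (f + 1) = 2 * (n : ℝ) →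
      (max (dowMetschBound n - 1) ((n : ℝ) ^ 2 - f) < (A.card : ℝ) →
        (∃ p : P, valency A p = 0) ∧ EmbedsInProjectivePlane n A) ∧
      ((A.card : ℝ) = (n : ℝ) ^ 2 - f → dowMetschBound n - 1 ≤ (n : ℝ) ^ 2 - f →
        ((∃ p : P, valency A p = 0) ∧ EmbedsInProjectivePlane n A) ∨
        ∃ t u : ℕ, (t : ℝ) = (n : ℝ) - f ∧ (u : ℝ) = (n : ℝ) + f + 2 ∧
          ∃ (Q : Type) (_ : Fintype Q) (_ : DecidableEq Q)
            (G : Finpartition (Finset.univ : Finset Q)) (B : Finset (Finset Q)),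
            IsGroupDivisibleDesign n t u G B ∧
              (Fintype.card Q : ℝ) = (n : ℝ) ^ 2 - f ∧ (B.card : ℝ) = (n : ℝ) ^ 2 - f) := by
  refine ⟨hA.card_le_max hpar hnot, fun f hf hfn =>
    ⟨hA.embeds_of_lt hpar hnot hf hfn, fun hcard hg => ?_⟩⟩
  have hle : A.card ≤ n ^ 2 := by
    have : (A.card : ℝ) ≤ n ^ 2 := by linarith
    exact_mod_cast this
  -- In the equality case `f = n ^ 2 - A.card` is a natural number.
  obtain ⟨e, he⟩ := Nat.exists_eq_add_of_le hle
  have he' : (n : ℝ) ^ 2 = A.card + e := by exact_mod_cast he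
  obtain rfl : f = e := by linarith
  rcases hA.embeds_or_exists_groupDivisibleDesign hpar hnot (e := e) (by exact_mod_cast hfn)
    he.symm (by linarith) with h | ⟨t, u, ht, hu, G, D, hD, hDc⟩
  · exact Or.inl h
  · refine Or.inr ⟨t, u, ?_, by rw [hu]; push_cast; ring, Fin A.card, inferInstance,
      inferInstance, G, D, hD, ?_, ?_⟩
    · rw [← ht]
      push_cast
      ring
    · rw [Fintype.card_fin, hcard]
    · rw [hDc, hcard]
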